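/- **Setting.** The input consists of $m$ sets $S_1,\dots,S_m\subseteq\{1,\dots,n\}$ and an integer $1\le k\le m$, and every element of the universe lies in at most $r$ of the sets. For $C\subseteq\{1,\dots,m\}$ let $\psi(C)$ be the set of elements that lie in at least one $S_i$ with $i\in C$, and $\tilde\psi(C)$ the set of elements that lie in exactly one $S_i$ with $i\in C$. *Maximum Coverage* asks to maximize $|\psi(C)|$, and *Unique Coverage* to maximize $|\tilde\psi(C)|$, over all $C$ with $|C|\le k$. A $(1+\varepsilon)$-approximation is a $C$ with $|C|\le k$ whose value is at least $1/(1+\varepsilon)$ times the maximum. **Streaming model.** The sets arrive in the order $S_1,\dots,S_m$, each one element by element (in arbitrary order, each element once) and followed by an end-of-set marker. A randomized one-pass algorithm is given $n,m,k,r$ and a rational $\varepsilon\in(0,1]$ in advance. It draws a uniformly random number from a finite range, which determines the initial content of its memory; afterwards the content of the memory after each token is a computable function of the parameters, the previous content and the token, and the answer is a computable function of the parameters and the final content. Its space is the maximum number of bits that the memory holds at any time between two tokens, for the worst random choice; random bits that are needed later have to be kept in memory. **Theorem.** For every $\gamma\in\mathbb N$ there are constants $K,c$ and one randomized one-pass algorithm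 such that, for all $n,m,k,r$ with $1\le k\le m$, all rational $\varepsilon\in(0,1]$ and every input as above, the algorithm uses at most $$K\,\varepsilon^{-4}k^3r\,\bigl(\log(m+n+2)\bigr)^{c}$$ bits of space, that is $\tilde O(\varepsilon^{-4}k^3r)$, and with probability at least $1-(m+1)^{-\gamma}$ it outputs both a $(1+\varepsilon)$-approximation to Unique Coverage and a $(1+\varepsilon)$-approximation to Maximum Coverage (each as a list of the positions of the chosen sets). -/

import Mathlib

namespace StreamCoverage

/-! ### Coverage problems.  The input sets are `S 0, …, S (m - 1)`, subsets of a universe with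
`n` elements; a solution is a set `C` of indices, of size at most `k`. -/

/-- Elements that lie in at least one of the sets with index in `C`. -/
def covered {n m : ℕ} (S : Fin m → Finset (Fin n)) (C : Finset (Fin m)) : Finset (Fin n) :=
  Finset.univ.filter fun u => 1 ≤ (C.filter fun i => u ∈ S i).card

/-- Elements that lie in exactly one of the sets with index in `C`. -/
def uniquelyCovered {n m : ℕ} (S : Fin m → Finset (Fin n)) (C : Finset (Fin m)) :
    Finset (Fin n) :=
  Finset.univ.filter fun u => (C.filter fun i => u ∈ S i).card = 1

/-- Largest value of `val` over all collections of at most `k` of the `m` sets. -/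
def optimum {m : ℕ} (k : ℕ) (val : Finset (Fin m) → ℕ) : ℕ :=
  (Finset.univ.filter fun C : Finset (Fin m) => C.card ≤ k).sup val

/-- Number of sets in which the element `u` appears. -/
def multiplicity {n m : ℕ} (S : Fin m → Finset (Fin n)) (u : Fin n) : ℕ :=
  (Finset.univ.filter fun i => u ∈ S i).card

/-- The collection of sets whose (0-based) positions are listed in `l`. -/
def selection (m : ℕ) (l : List ℕ) : Finset (Fin m) :=
  Finset.univ.filter fun i => i.val ∈ l

/-- `l` lists the positions of at most `k` of the `m` sets, and the value of this collection
is within a factor `1 + ε` of the optimum. -/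
def IsApprox {m : ℕ} (k : ℕ) (ε : ℝ) (val : Finset (Fin m) → ℕ) (l : List ℕ) : Prop :=
  (∀ i ∈ l, i < m) ∧ (selection m l).card ≤ k ∧
    (optimum k val : ℝ) ≤ (1 + ε) * (val (selection m l) : ℝ)

/-! ### Streams.  A token `some u` announces the element `u` of the current set, and a token
`none` announces that the current set is complete. -/

/-- `w i` lists the elements of `S i`, each once, in some order. -/
def Lists {n m : ℕ} (w : Fin m → List (Fin n)) (S : Fin m → Finset (Fin n)) : Prop :=
  ∀ i, (w i).Nodup ∧ (w i).toFinset = S i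

/-- The stream in which the sets arrive one after the other, each of them element by element. -/
def stream {n m : ℕ} (w : Fin m → List (Fin n)) : List (Option ℕ) :=
  (List.finRange m).flatMap fun i => (w i).map (fun u => some u.val) ++ [none]

/-! ### Randomized one-pass algorithms -/

/-- What the algorithm is given in advance: `(n, m, k, r, a, b)`, where the accuracy is
`ε = a / b`. -/
abbrev Params := ℕ × ℕ × ℕ × ℕ × ℕ × ℕ

/-- A (uniform) randomized one-pass algorithm.  The content of its memory is a bit string, written
as a natural number.  It draws a uniformly random number below `seeds p`, which determines
the initial content of the memory; whatever it needs to know later about this number has to be kept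
in memory.  The content after a token is a function of the content before it and of the token
alone; the answer (one solution for each of two problems) is a function of the final content.
One and the same computable procedure serves all parameters. -/
structure OnePassAlgorithm where
  seeds : Params → ℕ
  start : Params → ℕ → ℕ
  step : Params → ℕ → Option ℕ → ℕ
  answer : Params → ℕ → List ℕ × List ℕ
  seeds_pos : ∀ p, 0 < seeds p
  computable_seeds : Computable seeds
  computable_start : Computable₂ start
  computable_step : Computable fun x : Params × ℕ × Option ℕ => step x.1 x.2.1 x.2.2
  computable_answer : Computable₂ answer

namespace OnePassAlgorithm

/-- Memory content after reading `t`, when the random number drawn is `ω`. -/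
def memory (A : OnePassAlgorithm) (p : Params) (ω : ℕ) (t : List (Option ℕ)) : ℕ :=
  t.foldl (A.step p) (A.start p ω)

/-- On the input stream `t` the memory never holds more than `s` bits, whatever the random
choices and at whatever time (`Nat.size x` is the number of binary digits of `x`). -/
def UsesSpaceAtMost (A : OnePassAlgorithm) (p : Params) (t : List (Option ℕ)) (s : ℝ) : Prop :=
  ∀ ω < A.seeds p, ∀ t', t' <+: t → (Nat.size (A.memory p ω t') : ℝ) ≤ s

/-- Probability that the answer on the input stream `t` satisfies `P`. -/
noncomputable def prob (A : OnePassAlgorithm) (p : Params) (t : List (Option ℕ))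
    (P : List ℕ × List ℕ → Prop) : ℝ :=
  (Set.ncard {ω : ℕ | ω < A.seeds p ∧ P (A.answer p (A.memory p ω t))} : ℝ) / (A.seeds p : ℝ)

end OnePassAlgorithm

end StreamCoverage

namespace StreamCoverage

/-! ### Primitive recursive functions, in the form that `fun_prop` uses -/

/-- Membership in a list, as a Boolean. -/
def memList {β : Type*} [DecidableEq β] (x : β) (l : List β) : Bool := decide (x ∈ l)

theorem memList_eq_true {β : Type*} [DecidableEq β] {x : β} {l : List β} : memList x l = true ↔ x ∈ l :=
  decide_eq_true_iff

section Primrec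

variable {α β δ : Type*} [Primcodable α] [Primcodable β] [Primcodable δ]

attribute [fun_prop] Primrec

@[fun_prop]
theorem primrec_id' : Primrec fun x : α => x := Primrec.id

@[fun_prop]
theorem primrec_const (b : β) : Primrec fun _ : α => b := Primrec.const b

@[fun_prop]
theorem primrec_comp {f : β → δ} {g : α → β} (hf : Primrec f) (hg : Primrec g) :
    Primrec fun x => f (g x) := hf.comp hg

@[fun_prop]
theorem primrec_prodMk {f : α → β} {g : α → δ} (hf : Primrec f) (hg : Primrec g) :
    Primrec fun x => (f x, g x) := hf.pair hg

@[fun_prop]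
theorem primrec_fst {f : α → β × δ} (hf : Primrec f) : Primrec fun x => (f x).1 :=
  Primrec.fst.comp hf

@[fun_prop]
theorem primrec_snd {f : α → β × δ} (hf : Primrec f) : Primrec fun x => (f x).2 :=
  Primrec.snd.comp hf

@[fun_prop]
theorem primrec_add {f g : α → ℕ} (hf : Primrec f) (hg : Primrec g) :
    Primrec fun x => f x + g x := Primrec.nat_add.comp hf hg

@[fun_prop]
theorem primrec_sub {f g : α → ℕ} (hf : Primrec f) (hg : Primrec g) :
    Primrec fun x => f x - g x := Primrec.nat_sub.comp hf hg

@[fun_prop]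
theorem primrec_mul {f g : α → ℕ} (hf : Primrec f) (hg : Primrec g) :
    Primrec fun x => f x * g x := Primrec.nat_mul.comp hf hg

@[fun_prop]
theorem primrec_div {f g : α → ℕ} (hf : Primrec f) (hg : Primrec g) :
    Primrec fun x => f x / g x := Primrec.nat_div.comp hf hg

@[fun_prop]
theorem primrec_mod {f g : α → ℕ} (hf : Primrec f) (hg : Primrec g) :
    Primrec fun x => f x % g x := Primrec.nat_mod.comp hf hg

@[fun_prop]
theorem primrec_pow {f g : α → ℕ} (hf : Primrec f) (hg : Primrec g) :
    Primrec fun x => f x ^ g x :=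
  (Primrec₂.unpaired'.1 Nat.Primrec.pow).comp hf hg

@[fun_prop]
theorem primrec_min {f g : α → ℕ} (hf : Primrec f) (hg : Primrec g) :
    Primrec fun x => min (f x) (g x) := Primrec.nat_min.comp hf hg

@[fun_prop]
theorem primrec_natPair {f g : α → ℕ} (hf : Primrec f) (hg : Primrec g) :
    Primrec fun x => Nat.pair (f x) (g x) := Primrec₂.natPair.comp hf hg

@[fun_prop]
theorem primrec_unpair {f : α → ℕ} (hf : Primrec f) : Primrec fun x => Nat.unpair (f x) :=
  Primrec.unpair.comp hf

@[fun_prop]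
theorem primrec_decide_le {f g : α → ℕ} (hf : Primrec f) (hg : Primrec g) :
    Primrec fun x => decide (f x ≤ g x) := Primrec.nat_le.decide.comp hf hg

@[fun_prop]
theorem primrec_decide_lt {f g : α → ℕ} (hf : Primrec f) (hg : Primrec g) :
    Primrec fun x => decide (f x < g x) := Primrec.nat_lt.decide.comp hf hg

@[fun_prop]
theorem primrec_decide_eq [DecidableEq β] {f g : α → β} (hf : Primrec f) (hg : Primrec g) :
    Primrec fun x => decide (f x = g x) := Primrec.eq.decide.comp hf hg

@[fun_prop]
theorem primrec_and {f g : α → Bool} (hf : Primrec f) (hg : Primrec g) :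
    Primrec fun x => (f x && g x) := Primrec.and.comp hf hg

@[fun_prop]
theorem primrec_not {f : α → Bool} (hf : Primrec f) :
    Primrec fun x => !(f x) := Primrec.not.comp hf

@[fun_prop]
theorem primrec_cond {c : α → Bool} {f g : α → β} (hc : Primrec c) (hf : Primrec f)
    (hg : Primrec g) : Primrec fun x => bif c x then f x else g x := Primrec.cond hc hf hg

@[fun_prop]
theorem primrec_optionElim {o : α → Option β} {f : α → δ} {g : α → β → δ} (ho : Primrec o)
    (hf : Primrec f) (hg : Primrec fun z : α × β => g z.1 z.2) :
    Primrec fun x => (o x).elim (f x) (g x) :=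
  (Primrec.option_casesOn ho hf hg).of_eq fun x => by cases o x <;> rfl

@[fun_prop]
theorem primrec_cons {f : α → β} {g : α → List β} (hf : Primrec f) (hg : Primrec g) :
    Primrec fun x => f x :: g x := Primrec.list_cons.comp hf hg

@[fun_prop]
theorem primrec_append {f g : α → List β} (hf : Primrec f) (hg : Primrec g) :
    Primrec fun x => f x ++ g x := Primrec.list_append.comp hf hg

@[fun_prop]
theorem primrec_length {f : α → List β} (hf : Primrec f) : Primrec fun x => (f x).length :=
  Primrec.list_length.comp hf

@[fun_prop]
theorem primrec_range {f : α → ℕ} (hf : Primrec f) : Primrec fun x => List.range (f x) :=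
  Primrec.list_range.comp hf

@[fun_prop]
theorem primrec_map {f : α → List β} {g : α → β → δ} (hf : Primrec f)
    (hg : Primrec fun z : α × β => g z.1 z.2) : Primrec fun x => (f x).map (g x) :=
  Primrec.list_map hf hg

@[fun_prop]
theorem primrec_filter {f : α → List β} {g : α → β → Bool} (hf : Primrec f)
    (hg : Primrec fun z : α × β => g z.1 z.2) : Primrec fun x => (f x).filter (g x) := by
  have h : Primrec fun x => (f x).filterMap fun y => bif g x y then some y else none :=
    Primrec.listFilterMap hf
      (Primrec.cond hg (Primrec.option_some.comp Primrec.snd) (Primrec.const none))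
  refine h.of_eq fun x => ?_
  induction f x with
  | nil => rfl
  | cons y l ih => cases h : g x y <;> simp [h, ih]

@[fun_prop]
theorem primrec_foldl {f : α → List β} {g : α → δ → β → δ} {d : α → δ} (hf : Primrec f)
    (hg : Primrec fun z : α × δ × β => g z.1 z.2.1 z.2.2) (hd : Primrec d) :
    Primrec fun x => (f x).foldl (g x) (d x) :=
  Primrec.list_foldl (h := fun x z => g x z.1 z.2) hf hd hg

@[fun_prop]
theorem primrec_foldr {f : α → List β} {g : α → β → δ → δ} {d : α → δ} (hf : Primrec f)
    (hg : Primrec fun z : α × β × δ => g z.1 z.2.1 z.2.2) (hd : Primrec d) :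
    Primrec fun x => (f x).foldr (g x) (d x) :=
  Primrec.list_foldr (h := fun x z => g x z.1 z.2) hf hd hg

@[fun_prop]
theorem primrec_memList [DecidableEq β] {f : α → β} {g : α → List β}
    (hf : Primrec f) (hg : Primrec g) : Primrec fun x => memList (f x) (g x) := by
  have h : Primrec fun x => decide ((g x).idxOf (f x) < (g x).length) :=
    primrec_decide_lt (Primrec.list_idxOf.comp hf hg) (primrec_length hg)
  exact h.of_eq fun x => by simp [memList, List.idxOf_lt_length_iff]

@[fun_prop]
theorem primrec_log {f g : α → ℕ} (hf : Primrec f) (hg : Primrec g) :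
    Primrec fun x => Nat.log (f x) (g x) := by
  have h : Primrec fun x => ((List.range (g x)).filter
      fun i => decide (1 < f x) && decide (f x ^ (i + 1) ≤ g x)).length := by fun_prop
  refine h.of_eq fun x => ?_
  rcases Nat.lt_or_ge 1 (f x) with h1 | h1
  · rcases Nat.eq_zero_or_pos (g x) with h0 | h0
    · simp [h0]
    have : (List.range (g x)).filter (fun i => decide (1 < f x) && decide (f x ^ (i + 1) ≤ g x))
        = (List.range (g x)).filter (fun i => decide (i < Nat.log (f x) (g x))) := by
      refine List.filter_congr fun i _ => ?_
      simp [h1, ← Nat.succ_le_iff, Nat.le_log_iff_pow_le h1 h0.ne']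
    rw [this, ← List.countP_eq_length_filter]
    have hc : ∀ a b : ℕ, a ≤ b → (List.range b).countP (fun i => decide (i < a)) = a := by
      intro a b hab
      obtain ⟨c, rfl⟩ := Nat.exists_eq_add_of_le hab
      rw [List.range_add, List.countP_append, List.countP_eq_length.2, List.countP_eq_zero.2]
      · simp
      · simp
      · simp
    exact hc _ _ (Nat.log_le_self _ _)
  · simp [Nat.log_of_left_le_one h1, Nat.not_lt.2 h1]

theorem primrecPred_prime : PrimrecPred Nat.Prime := by
  have h : Primrec fun p : ℕ => decide (2 ≤ p) && decide (((List.range p).filter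
      fun d => decide (2 ≤ d) && decide (p % d = 0)).length = 0) := by fun_prop
  refine Primrec.primrecPred (h.of_eq fun p => ?_)
  rw [Bool.eq_iff_iff, decide_eq_true_iff, Nat.prime_def_lt']
  simp only [Bool.and_eq_true, decide_eq_true_eq, List.length_eq_zero_iff, List.filter_eq_nil_iff,
    List.mem_range, not_and, Nat.dvd_iff_mod_eq_zero]
  exact and_congr_right fun _ => ⟨fun h d h2 hd => h d hd h2, fun h d hd h2 => h d h2 hd⟩

end Primrec

/-! ### Lists of small numbers, written as one number -/

/-- The number with digits `l` in base `B`, lowest first, and leading digit `1`. -/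
def encodeList (B : ℕ) (l : List ℕ) : ℕ := l.foldr (fun d x => d + B * x) 1

/-- The digits of `x` in base `B`, without the leading one. -/
def decodeList (B x : ℕ) : List ℕ := (List.range (Nat.log B x)).map fun i => x / B ^ i % B

/-- An element of `l` at which `f` is largest; `d` if there is none that beats `d`. -/
def pick {α : Type*} (f : α → ℕ) (d : α) (l : List α) : α :=
  l.foldl (fun x y => bif decide (f x < f y) then y else x) d

/-- All sublists of `l`. -/
def subs {α : Type*} (l : List α) : List (List α) :=
  l.foldr (fun x r => r ++ r.map fun y => x :: y) [[]]

@[fun_prop]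
theorem primrec_encodeList {α : Type*} [Primcodable α] {f : α → ℕ} {g : α → List ℕ}
    (hf : Primrec f) (hg : Primrec g) : Primrec fun x => encodeList (f x) (g x) := by
  unfold encodeList; fun_prop

@[fun_prop]
theorem primrec_decodeList {α : Type*} [Primcodable α] {f g : α → ℕ}
    (hf : Primrec f) (hg : Primrec g) : Primrec fun x => decodeList (f x) (g x) := by
  unfold decodeList; fun_prop

@[fun_prop]
theorem primrec_pick {α β : Type*} [Primcodable α] [Primcodable β] {f : α → β → ℕ} {d : α → β}
    {l : α → List β} (hf : Primrec fun z : α × β => f z.1 z.2) (hd : Primrec d) (hl : Primrec l) :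
    Primrec fun x => pick (f x) (d x) (l x) := by
  unfold pick
  have h1 : Primrec fun z : α × β × β => f z.1 z.2.1 :=
    hf.comp (g := fun z : α × β × β => (z.1, z.2.1)) (by fun_prop)
  have h2 : Primrec fun z : α × β × β => f z.1 z.2.2 :=
    hf.comp (g := fun z : α × β × β => (z.1, z.2.2)) (by fun_prop)
  fun_prop

@[fun_prop]
theorem primrec_subs {α β : Type*} [Primcodable α] [Primcodable β]
    {f : α → List β} (hf : Primrec f) : Primrec fun x => subs (f x) := by
  unfold subs; fun_prop

/-! ### The algorithm -/

/-- A prime between `n + 1` and `2 * (n + 1)`. -/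
def prm (n : ℕ) : ℕ := Nat.findGreatest Nat.Prime (2 * (n + 1))

/-- Inverse precision. -/
def prec (p : Params) : ℕ := 6 * (p.2.2.2.2.2 / p.2.2.2.2.1 + 1)

/-- An upper bound for the harmonic numbers. -/
def harm (k : ℕ) : ℕ := Nat.log 2 k + 2

/-- Number of sets kept. -/
def width (p : Params) : ℕ :=
  p.2.2.1 + 2 * p.2.2.1 * p.2.2.2.1 * harm p.2.2.1 * prec p

/-- Number of independent samples. -/
def reps (γ : ℕ) (p : Params) : ℕ := 1 + (p.2.2.1 + γ) * (Nat.log 2 (p.2.1 + 1) + 1)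

/-- Number of sampling rates. -/
def levels (p : Params) : ℕ := Nat.log 2 p.1 + 1

/-- The sampling rate for sets of size about `2 ^ j` is `thr p j / prm p.1`. -/
def thr (p : Params) (j : ℕ) : ℕ :=
  min (prm p.1) (prm p.1 * (32 * prec p ^ 2) / 2 ^ j + 1)

/-- Number of sampled elements stored for every set and every sample. -/
def cap (p : Params) : ℕ := 32 * p.2.2.1 * (64 * prec p ^ 2 + 1)

/-- Digit `l` of the random number. -/
def digit (q ω l : ℕ) : ℕ := ω / q ^ l % q

/-- The pairwise independent hash function with seed `d`. -/
def hash (q d u : ℕ) : ℕ := (d / q * u + d % q) % q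

/-- Whether the element `u` is in the sample `x`; the sample `x = j * reps γ p + l` is the `l`-th
one at rate `j`. -/
def sampled (γ : ℕ) (p : Params) (ω x u : ℕ) : Bool :=
  decide (hash (prm p.1) (digit (prm p.1 * prm p.1) ω (x % reps γ p)) u < thr p (x / reps γ p))

/-- The random number, the position of the current set, its size, the positions and sizes of the
sets kept, and the sampled incidences `(i, x, u)`: the element `u` of the set `i` is in the
sample `x`. -/
abbrev State := ℕ × ℕ × ℕ × List (ℕ × ℕ) × List (ℕ × ℕ × ℕ)

/-- Number of incidences stored for the set `i` and the sample `x`. -/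
def load (recs : List (ℕ × ℕ × ℕ)) (i x : ℕ) : ℕ :=
  (recs.filter fun e => decide (e.1 = i) && decide (e.2.1 = x)).length

/-- An element of the current set arrives. -/
def addElement (γ : ℕ) (p : Params) (s : State) (u : ℕ) : State :=
  (s.1, s.2.1, s.2.2.1 + 1, s.2.2.2.1, s.2.2.2.2 ++
    ((List.range (levels p * reps γ p)).filter fun x =>
      sampled γ p s.1 x u && decide (load s.2.2.2.2 s.2.1 x < cap p)).map fun x => (s.2.1, x, u))

/-- The smallest set among those kept and the current one. -/
def smallest (p : Params) (s : State) : ℕ :=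
  (pick (fun e : ℕ × ℕ => p.1 - e.2) (s.2.1, s.2.2.1) s.2.2.2.1).1

/-- The current set is complete. -/
def closeSet (p : Params) (s : State) : State :=
  bif decide (s.2.2.2.1.length < width p) then
    (s.1, s.2.1 + 1, 0, (s.2.1, s.2.2.1) :: s.2.2.2.1, s.2.2.2.2)
  else
    (s.1, s.2.1 + 1, 0,
      ((s.2.1, s.2.2.1) :: s.2.2.2.1).filter (fun e => !decide (e.1 = smallest p s)),
      s.2.2.2.2.filter fun e => !decide (e.1 = smallest p s))

/-- The new state after a token. -/
def update (γ : ℕ) (p : Params) (s : State) (t : Option ℕ) : State :=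
  t.elim (closeSet p s) (addElement γ p s)

/-- Exceeds all numbers that occur in the lists of the state. -/
def base (γ : ℕ) (p : Params) : ℕ := (p.2.1 + p.1 + levels p * reps γ p + 2) ^ 4

/-- Writes a state into the memory. -/
def pack (B : ℕ) (s : State) : ℕ :=
  Nat.pair s.1 (Nat.pair s.2.1 (Nat.pair s.2.2.1 (Nat.pair
    (encodeList B (s.2.2.2.1.map fun e => Nat.pair e.1 e.2))
    (encodeList B (s.2.2.2.2.map fun e => Nat.pair e.1 (Nat.pair e.2.1 e.2.2))))))

/-- Reads a state from the memory. -/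
def unpack (B x : ℕ) : State :=
  (x.unpair.1, x.unpair.2.unpair.1, x.unpair.2.unpair.2.unpair.1,
    (decodeList B x.unpair.2.unpair.2.unpair.2.unpair.1).map (fun e => (e.unpair.1, e.unpair.2)),
    (decodeList B x.unpair.2.unpair.2.unpair.2.unpair.2).map
      fun e => (e.unpair.1, e.unpair.2.unpair.1, e.unpair.2.unpair.2))

/-- Number of elements of the sample `x` for which the number of sets listed in `D` that contain
it satisfies `g`. -/
def sampleVal (g : ℕ → Bool) (n : ℕ) (recs : List (ℕ × ℕ × ℕ)) (x : ℕ) (D : List ℕ) : ℕ :=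
  ((List.range n).filter fun u => g (D.filter fun i => memList (i, x, u) recs).length).length

/-- The median of the values of `D` in the samples of level `j`. -/
def score (g : ℕ → Bool) (γ : ℕ) (p : Params) (recs : List (ℕ × ℕ × ℕ)) (j : ℕ) (D : List ℕ) : ℕ :=
  ((List.range p.1).filter fun v => decide (reps γ p ≤ 2 * ((List.range (reps γ p)).filter
    fun l => decide (v < sampleVal g p.1 recs (j * reps γ p + l) D)).length)).length

/-- The sampling level to be used. -/
def level (sizes : List (ℕ × ℕ)) : ℕ := Nat.log 2 (pick Prod.snd (0, 0) sizes).2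

/-- The solution that is best according to the samples. -/
def solve (g : ℕ → Bool) (γ : ℕ) (p : Params) (s : State) : List ℕ :=
  pick (score g γ p s.2.2.2.2 (level s.2.2.2.1)) []
    ((subs (s.2.2.2.1.map fun e => e.1)).filter fun D => decide (D.length ≤ p.2.2.1))

section Primrec

variable {α : Type*} [Primcodable α]

@[fun_prop]
theorem primrec_prm {f : α → ℕ} (hf : Primrec f) : Primrec fun x => prm (f x) := by
  have h : Primrec prm := Primrec.nat_findGreatest (f := fun n => 2 * (n + 1))
    (p := fun _ q => Nat.Prime q) (by fun_prop) (primrecPred_prime.comp Primrec.snd)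
  exact h.comp hf

@[fun_prop]
theorem primrec_prec : Primrec prec := by unfold prec; fun_prop

@[fun_prop]
theorem primrec_harm : Primrec harm := by unfold harm; fun_prop

@[fun_prop]
theorem primrec_width : Primrec width := by unfold width; fun_prop

@[fun_prop]
theorem primrec_reps (γ : ℕ) : Primrec (reps γ) := by unfold reps; fun_prop

@[fun_prop]
theorem primrec_levels : Primrec levels := by unfold levels; fun_prop

@[fun_prop]
theorem primrec_thr {f : α → Params} {g : α → ℕ} (hf : Primrec f) (hg : Primrec g) :
    Primrec fun x => thr (f x) (g x) := by unfold thr; fun_prop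

@[fun_prop]
theorem primrec_cap : Primrec cap := by unfold cap; fun_prop

@[fun_prop]
theorem primrec_digit {f g h : α → ℕ} (hf : Primrec f) (hg : Primrec g) (hh : Primrec h) :
    Primrec fun x => digit (f x) (g x) (h x) := by unfold digit; fun_prop

@[fun_prop]
theorem primrec_hash {f g h : α → ℕ} (hf : Primrec f) (hg : Primrec g) (hh : Primrec h) :
    Primrec fun x => hash (f x) (g x) (h x) := by unfold hash; fun_prop

@[fun_prop]
theorem primrec_sampled (γ : ℕ) {f : α → Params} {g h i : α → ℕ} (hf : Primrec f)
    (hg : Primrec g) (hh : Primrec h) (hi : Primrec i) :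
    Primrec fun x => sampled γ (f x) (g x) (h x) (i x) := by unfold sampled; fun_prop

@[fun_prop]
theorem primrec_load {f : α → List (ℕ × ℕ × ℕ)} {g h : α → ℕ} (hf : Primrec f)
    (hg : Primrec g) (hh : Primrec h) : Primrec fun x => load (f x) (g x) (h x) := by
  unfold load; fun_prop

@[fun_prop]
theorem primrec_addElement (γ : ℕ) {f : α → Params} {g : α → State} {h : α → ℕ} (hf : Primrec f)
    (hg : Primrec g) (hh : Primrec h) : Primrec fun x => addElement γ (f x) (g x) (h x) := by
  unfold addElement; fun_prop

@[fun_prop]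
theorem primrec_smallest {f : α → Params} {g : α → State} (hf : Primrec f)
    (hg : Primrec g) : Primrec fun x => smallest (f x) (g x) := by
  unfold smallest; fun_prop

@[fun_prop]
theorem primrec_closeSet {f : α → Params} {g : α → State} (hf : Primrec f)
    (hg : Primrec g) : Primrec fun x => closeSet (f x) (g x) := by
  unfold closeSet; fun_prop

@[fun_prop]
theorem primrec_update (γ : ℕ) {f : α → Params} {g : α → State} {h : α → Option ℕ}
    (hf : Primrec f) (hg : Primrec g) (hh : Primrec h) :
    Primrec fun x => update γ (f x) (g x) (h x) := by
  unfold update; fun_prop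

@[fun_prop]
theorem primrec_base (γ : ℕ) : Primrec (base γ) := by unfold base; fun_prop

@[fun_prop]
theorem primrec_pack {f : α → ℕ} {g : α → State} (hf : Primrec f) (hg : Primrec g) :
    Primrec fun x => pack (f x) (g x) := by unfold pack; fun_prop

@[fun_prop]
theorem primrec_unpack {f g : α → ℕ} (hf : Primrec f) (hg : Primrec g) :
    Primrec fun x => unpack (f x) (g x) := by unfold unpack; fun_prop

theorem primrec_sampleVal {g : ℕ → Bool} (hg : Primrec g) {n : α → ℕ}
    {f : α → List (ℕ × ℕ × ℕ)} {x : α → ℕ} {D : α → List ℕ} (hn : Primrec n) (hf : Primrec f)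
    (hx : Primrec x) (hD : Primrec D) :
    Primrec fun y => sampleVal g (n y) (f y) (x y) (D y) := by
  unfold sampleVal
  have h : Primrec fun z : α × ℕ =>
      ((D z.1).filter fun i => memList (i, x z.1, z.2) (f z.1)).length := by clear hg; fun_prop
  exact primrec_length (primrec_filter (by fun_prop) (hg.comp h))

theorem primrec_score {g : ℕ → Bool} (hg : Primrec g) (γ : ℕ) {p : α → Params}
    {f : α → List (ℕ × ℕ × ℕ)} {j : α → ℕ} {D : α → List ℕ} (hp : Primrec p) (hf : Primrec f)
    (hj : Primrec j) (hD : Primrec D) :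
    Primrec fun y => score g γ (p y) (f y) (j y) (D y) := by
  unfold score
  have h : Primrec fun z : (α × ℕ) × ℕ => sampleVal g (p z.1.1).1 (f z.1.1)
      (j z.1.1 * reps γ (p z.1.1) + z.2) (D z.1.1) :=
    primrec_sampleVal hg (by fun_prop) (by fun_prop) (by fun_prop) (by fun_prop)
  clear hg
  fun_prop

@[fun_prop]
theorem primrec_level {f : α → List (ℕ × ℕ)} (hf : Primrec f) :
    Primrec fun x => level (f x) := by unfold level; fun_prop

theorem primrec_solve {g : ℕ → Bool} (hg : Primrec g) (γ : ℕ) {p : α → Params} {s : α → State}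
    (hp : Primrec p) (hs : Primrec s) : Primrec fun y => solve g γ (p y) (s y) := by
  unfold solve
  have h : Primrec fun z : α × List ℕ => score g γ (p z.1) (s z.1).2.2.2.2
      (level (s z.1).2.2.2.1) z.2 :=
    primrec_score hg γ (by fun_prop) (by fun_prop) (by fun_prop) (by fun_prop)
  clear hg
  fun_prop

end Primrec

theorem prm_pos (n : ℕ) : 0 < prm n := by
  refine Nat.pos_of_ne_zero fun h => ?_
  rw [prm, Nat.findGreatest_eq_zero_iff] at h
  exact h (n := 2) (by norm_num) (by omega) Nat.prime_two

/-- The initial memory. -/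
def startMemory (γ : ℕ) (p : Params) (ω : ℕ) : ℕ :=
  bif decide (p.2.2.2.1 = 0) then 0 else pack (base γ p) (ω, 0, 0, [], [])

/-- The memory after a token. -/
def stepMemory (γ : ℕ) (p : Params) (x : ℕ) (t : Option ℕ) : ℕ :=
  bif decide (p.2.2.2.1 = 0) then 0 else
    pack (base γ p) (update γ p (unpack (base γ p) x) t)

/-- The two solutions computed from the final memory. -/
def output (γ : ℕ) (p : Params) (x : ℕ) : List ℕ × List ℕ :=
  bif decide (p.2.2.2.1 = 0) then ([], []) else
    (solve (fun c => decide (c = 1)) γ p (unpack (base γ p) x),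
      solve (fun c => decide (1 ≤ c)) γ p (unpack (base γ p) x))

theorem primrec_stepMemory (γ : ℕ) :
    Primrec fun z : Params × ℕ × Option ℕ => stepMemory γ z.1 z.2.1 z.2.2 := by
  unfold stepMemory; fun_prop

theorem primrec_output (γ : ℕ) : Primrec fun z : Params × ℕ => output γ z.1 z.2 := by
  have h : Primrec fun z : Params × ℕ => unpack (base γ z.1) z.2 := by fun_prop
  have h1 : Primrec fun c : ℕ => decide (c = 1) := by fun_prop
  have h2 : Primrec fun c : ℕ => decide (1 ≤ c) := by fun_prop
  exact primrec_cond (by fun_prop) (primrec_const _) (primrec_prodMk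
    (primrec_solve h1 γ Primrec.fst h) (primrec_solve h2 γ Primrec.fst h))

theorem primrec_startMemory (γ : ℕ) : Primrec fun z : Params × ℕ => startMemory γ z.1 z.2 := by
  unfold startMemory; fun_prop

/-- The algorithm. -/
def coverageAlgorithm (γ : ℕ) : OnePassAlgorithm where
  seeds p := (prm p.1 * prm p.1) ^ reps γ p
  start := startMemory γ
  step := stepMemory γ
  answer := output γ
  seeds_pos p := by have := prm_pos p.1; positivity
  computable_seeds := Primrec.to_comp (by fun_prop)
  computable_start := (primrec_startMemory γ).to_comp
  computable_step := (primrec_stepMemory γ).to_comp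
  computable_answer := (primrec_output γ).to_comp

/-! ### Values of solutions -/

section Values

variable {n m : ℕ} {g : ℕ → Bool} {S : Fin m → Finset (Fin n)}

/-- Number of sets of the solution `C` that contain `u`. -/
def hits (S : Fin m → Finset (Fin n)) (C : Finset (Fin m)) (u : Fin n) : ℕ :=
  (C.filter fun i => u ∈ S i).card

/-- Elements whose number of hits satisfies `g`. -/
def valueSet (g : ℕ → Bool) (S : Fin m → Finset (Fin n)) (C : Finset (Fin m)) : Finset (Fin n) :=
  Finset.univ.filter fun u => g (hits S C u) = true

/-- Number of elements whose number of hits satisfies `g`. -/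
def value (g : ℕ → Bool) (S : Fin m → Finset (Fin n)) (C : Finset (Fin m)) : ℕ :=
  (valueSet g S C).card

theorem uniquelyCovered_card (C : Finset (Fin m)) :
    (uniquelyCovered S C).card = value (fun c => decide (c = 1)) S C := by
  unfold uniquelyCovered value valueSet hits
  congr 1
  exact Finset.filter_congr fun u _ => decide_eq_true_iff.symm

theorem covered_card (C : Finset (Fin m)) :
    (covered S C).card = value (fun c => decide (1 ≤ c)) S C := by
  simp [covered, value, valueSet, hits]

theorem mem_covered {C : Finset (Fin m)} {u : Fin n} : u ∈ covered S C ↔ ∃ i ∈ C, u ∈ S i := by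
  simp [covered, Nat.one_le_iff_ne_zero, Finset.filter_eq_empty_iff]

theorem hits_eq_zero_iff {C : Finset (Fin m)} {u : Fin n} : hits S C u = 0 ↔ u ∉ covered S C := by
  simp [mem_covered, hits, Finset.filter_eq_empty_iff]

theorem hits_insert {C : Finset (Fin m)} {i : Fin m} (hi : i ∉ C) (u : Fin n) :
    hits S (insert i C) u = hits S C u + if u ∈ S i then 1 else 0 := by
  unfold hits
  rw [Finset.filter_insert]
  split_ifs with h
  · rw [Finset.card_insert_of_notMem (by simp [hi])]
  · simp

theorem value_insert_le {C : Finset (Fin m)} {i : Fin m} (hi : i ∉ C) :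
    value g S (insert i C) ≤ value g S C + (S i).card := by
  refine (Finset.card_le_card ?_).trans (Finset.card_union_le _ _)
  intro u hu
  by_cases h : u ∈ S i
  · simp [h]
  · simp only [valueSet, hits_insert hi, Finset.mem_filter, h, if_false, add_zero] at hu
    simp [valueSet, hu.2]

theorem valueSet_subset_covered (h0 : g 0 = false) (C : Finset (Fin m)) :
    valueSet g S C ⊆ covered S C := by
  intro u hu
  by_contra h
  rw [← hits_eq_zero_iff] at h
  simp [valueSet, h, h0] at hu

theorem le_value_insert (h0 : g 0 = false) (h1 : g 1 = true) {C : Finset (Fin m)} {j : Fin m}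
    (hj : j ∉ C) :
    value g S C + (S j).card ≤ value g S (insert j C) + 2 * (S j ∩ covered S C).card := by
  have hsub : (valueSet g S C \ S j) ∪ (S j \ covered S C) ⊆ valueSet g S (insert j C) := by
    intro u hu
    rw [Finset.mem_union, Finset.mem_sdiff, Finset.mem_sdiff] at hu
    simp only [valueSet, Finset.mem_filter, Finset.mem_univ, true_and, hits_insert hj] at hu ⊢
    rcases hu with ⟨hu, hj⟩ | ⟨hj, hu⟩
    · simpa [hj] using hu
    · simp [hj, hits_eq_zero_iff.2 hu, h1]
  have hdisj : Disjoint (valueSet g S C \ S j) (S j \ covered S C) :=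
    Finset.disjoint_left.2 fun u hu hu' =>
      (Finset.mem_sdiff.1 hu).2 (Finset.mem_sdiff.1 hu').1
  have hc := Finset.card_le_card hsub
  rw [Finset.card_union_of_disjoint hdisj] at hc
  have e1 := Finset.card_sdiff_add_card_inter (valueSet g S C) (S j)
  have e2 := Finset.card_sdiff_add_card_inter (S j) (covered S C)
  have e3 : (valueSet g S C ∩ S j).card ≤ (S j ∩ covered S C).card := by
    refine Finset.card_le_card fun u hu => ?_
    rw [Finset.mem_inter] at hu ⊢
    exact ⟨hu.2, valueSet_subset_covered h0 C hu.1⟩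
  unfold value
  omega

theorem value_singleton (h0 : g 0 = false) (h1 : g 1 = true) (i : Fin m) :
    value g S {i} = (S i).card := by
  unfold value valueSet hits
  congr 1
  ext u
  by_cases h : u ∈ S i <;> simp [Finset.filter_singleton, h, h0, h1]

theorem le_optimum {k : ℕ} (val : Finset (Fin m) → ℕ) {C : Finset (Fin m)} (hC : C.card ≤ k) :
    val C ≤ optimum k val :=
  Finset.le_sup (f := val) (by simpa using hC)

theorem exists_optimum (k : ℕ) (val : Finset (Fin m) → ℕ) :
    ∃ C : Finset (Fin m), C.card ≤ k ∧ val C = optimum k val := by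
  obtain ⟨C, hC, h⟩ := Finset.exists_mem_eq_sup
    (Finset.univ.filter fun C : Finset (Fin m) => C.card ≤ k) ⟨∅, by simp⟩ val
  exact ⟨C, by simpa using hC, h.symm⟩

theorem card_le_optimum (h0 : g 0 = false) (h1 : g 1 = true) {k : ℕ} (hk : 1 ≤ k) (i : Fin m) :
    (S i).card ≤ optimum k (value g S) := by
  rw [← value_singleton (g := g) h0 h1]
  exact le_optimum _ (by simpa using hk)

theorem sum_private_le_value (h1 : g 1 = true) (C : Finset (Fin m)) :
    ∑ i ∈ C, (S i \ covered S (C.erase i)).card ≤ value g S C := by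
  rw [← Finset.card_biUnion]
  · refine Finset.card_le_card fun u hu => ?_
    obtain ⟨i, hi, hu⟩ := Finset.mem_biUnion.1 hu
    rw [Finset.mem_sdiff, ← hits_eq_zero_iff] at hu
    have := hits_insert (S := S) (Finset.notMem_erase i C) u
    rw [Finset.insert_erase hi, hu.2, if_pos hu.1] at this
    simp [valueSet, this, h1]
  · intro i hi j hj hij
    refine Finset.disjoint_left.2 fun u hu hu' => ?_
    rw [Finset.mem_sdiff] at hu hu'
    exact hu.2 (mem_covered.2 ⟨j, Finset.mem_erase.2 ⟨hij.symm, hj⟩, hu'.1⟩)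

theorem covered_card_le_harmonic (h1 : g 1 = true) {k : ℕ} :
    ∀ (s : ℕ) (C : Finset (Fin m)), C.card = s → s ≤ k →
      ((covered S C).card : ℚ) ≤ harmonic s * optimum k (value g S) := by
  intro s
  induction s with
  | zero =>
    intro C hC _
    rw [Finset.card_eq_zero] at hC
    subst hC
    simp [covered]
  | succ s ih =>
    intro C hC hs
    have hne : C.Nonempty := Finset.card_pos.1 (by omega)
    obtain ⟨i, hi, hmin⟩ :=
      Finset.exists_min_image C (fun i => (S i \ covered S (C.erase i)).card) hne
    have h2 : (s + 1) * (S i \ covered S (C.erase i)).card ≤ optimum k (value g S) := by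
      calc (s + 1) * (S i \ covered S (C.erase i)).card
          ≤ ∑ i ∈ C, (S i \ covered S (C.erase i)).card := by
            rw [← hC, ← smul_eq_mul]
            exact Finset.card_nsmul_le_sum _ _ _ hmin
        _ ≤ value g S C := sum_private_le_value h1 C
        _ ≤ _ := le_optimum _ (by omega)
    have h3 : (covered S C).card ≤
        (covered S (C.erase i)).card + (S i \ covered S (C.erase i)).card := by
      refine (Finset.card_le_card fun u hu => ?_).trans (Finset.card_union_le _ _)
      obtain ⟨j, hj, hu⟩ := mem_covered.1 hu
      rw [Finset.mem_union, Finset.mem_sdiff]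
      by_cases hji : j = i
      · subst hji
        tauto
      · exact Or.inl (mem_covered.2 ⟨j, Finset.mem_erase.2 ⟨hji, hj⟩, hu⟩)
    have h4 := ih (C.erase i) (by rw [Finset.card_erase_of_mem hi]; omega) (by omega)
    have h5 : ((S i \ covered S (C.erase i)).card : ℚ) ≤
        ((s + 1 : ℕ) : ℚ)⁻¹ * optimum k (value g S) := by
      rw [inv_mul_eq_div, le_div_iff₀ (by positivity), mul_comm]
      exact_mod_cast h2
    rw [harmonic_succ, add_mul]
    have h6 : ((covered S C).card : ℚ) ≤
        (covered S (C.erase i)).card + (S i \ covered S (C.erase i)).card := by exact_mod_cast h3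
    linarith

theorem harmonic_le_harm {s k : ℕ} (h : s ≤ k) : harmonic s ≤ harm k := by
  have h1 : (harmonic s : ℝ) ≤ 1 + Real.log s := harmonic_le_one_add_log s
  have h2 : Real.log s ≤ Nat.log 2 k + 1 := by
    rcases Nat.eq_zero_or_pos s with rfl | hs
    · simp; positivity
    have h3 : (s : ℝ) ≤ 2 ^ (Nat.log 2 k + 1) := by
      exact_mod_cast h.trans (Nat.lt_pow_succ_log_self (by norm_num) k).le
    calc Real.log s ≤ Real.log (2 ^ (Nat.log 2 k + 1)) :=
          Real.log_le_log (by exact_mod_cast hs) h3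
      _ = (Nat.log 2 k + 1 : ℕ) * Real.log 2 := Real.log_pow _ _
      _ ≤ (Nat.log 2 k + 1 : ℕ) * 1 := by
          gcongr
          exact Real.log_two_lt_d9.le.trans (by norm_num)
      _ = _ := by push_cast; ring
  have h3 : (harmonic s : ℝ) ≤ (harm k : ℕ) := by
    unfold harm
    push_cast
    linarith
  exact_mod_cast h3

theorem covered_card_le (h1 : g 1 = true) {k : ℕ} {C : Finset (Fin m)} (hC : C.card ≤ k) :
    (covered S C).card ≤ harm k * optimum k (value g S) := by
  have h := covered_card_le_harmonic (S := S) h1 (k := k) _ C rfl hC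
  have h2 : (harmonic C.card : ℚ) * optimum k (value g S) ≤ harm k * optimum k (value g S) := by
    gcongr
    exact harmonic_le_harm hC
  exact_mod_cast h.trans h2

theorem sum_inter_le {r : ℕ} (hr : ∀ u, multiplicity S u ≤ r) (K : Finset (Fin m))
    (T : Finset (Fin n)) : ∑ j ∈ K, (S j ∩ T).card ≤ r * T.card := by
  have h : ∀ j, (S j ∩ T).card = ∑ u ∈ T, if u ∈ S j then 1 else 0 := by
    intro j
    rw [Finset.inter_comm, ← Finset.filter_mem_eq_inter, Finset.card_filter]
  simp_rw [h]
  rw [Finset.sum_comm, mul_comm, ← smul_eq_mul]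
  refine Finset.sum_le_card_nsmul _ _ _ fun u _ => ?_
  rw [← Finset.card_filter]
  exact (Finset.card_le_card (Finset.filter_subset_filter _ (Finset.subset_univ K))).trans (hr u)

/-- A collection that contains sufficiently many of the largest sets contains a solution that is
almost optimal. -/
theorem exists_value_ge (h0 : g 0 = false) (h1 : g 1 = true) {k r E : ℕ} (hr : 0 < r) (hk : 0 < k)
    (hE : 0 < E) (hS : ∀ u, multiplicity S u ≤ r) {K : Finset (Fin m)}
    (hK : ∀ i ∉ K, k + 2 * k * r * harm k * E ≤ K.card ∧ ∀ j ∈ K, (S i).card ≤ (S j).card) :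
    ∃ D ⊆ K, D.card ≤ k ∧
      E * optimum k (value g S) ≤ E * value g S D + optimum k (value g S) := by
  set O := optimum k (value g S) with hO
  have key : ∀ (s : ℕ) (C : Finset (Fin m)), (C \ K).card = s → C.card ≤ k →
      ∃ D ⊆ K, D.card ≤ k ∧ k * E * value g S C ≤ k * E * value g S D + s * O := by
    intro s
    induction s with
    | zero =>
      intro C hC hCk
      exact ⟨C, Finset.sdiff_eq_empty_iff_subset.1 (Finset.card_eq_zero.1 hC), hCk, by simp⟩
    | succ s ih =>
      intro C hC hCk
      obtain ⟨i, hi⟩ : (C \ K).Nonempty := Finset.card_pos.1 (by omega)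
      obtain ⟨hiC, hiK⟩ := Finset.mem_sdiff.1 hi
      obtain ⟨hcard, hlarge⟩ := hK i hiK
      obtain ⟨j, hj, hjx⟩ : ∃ j ∈ K \ C, k * E * (2 * (S j ∩ covered S C).card) ≤ O := by
        by_contra! hcon
        have hA : (K \ C).card * (O + 1) ≤
            ∑ j ∈ K \ C, k * E * (2 * (S j ∩ covered S C).card) := by
          rw [← smul_eq_mul]
          exact Finset.card_nsmul_le_sum _ _ _ hcon
        have hB : ∑ j ∈ K \ C, k * E * (2 * (S j ∩ covered S C).card) ≤
            2 * k * r * harm k * E * O := by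
          calc ∑ j ∈ K \ C, k * E * (2 * (S j ∩ covered S C).card)
              = 2 * k * E * ∑ j ∈ K \ C, (S j ∩ covered S C).card := by
                rw [Finset.mul_sum]
                exact Finset.sum_congr rfl fun _ _ => by ring
            _ ≤ 2 * k * E * (r * (harm k * O)) := by
                gcongr
                exact (sum_inter_le hS _ _).trans (by gcongr; exact covered_card_le h1 hCk)
            _ = _ := by ring
        have hD : 2 * k * r * harm k * E ≤ (K \ C).card := by
          have := Finset.le_card_sdiff C K
          omega
        have hpos : 0 < 2 * k * r * harm k * E := by
          have : 0 < harm k := by unfold harm; omega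
          positivity
        have := hA.trans hB
        nlinarith
      obtain ⟨hjK, hjC⟩ := Finset.mem_sdiff.1 hj
      have hjE : j ∉ C.erase i := fun h => hjC (Finset.mem_of_mem_erase h)
      have hCe : (C.erase i).card = C.card - 1 := Finset.card_erase_of_mem hiC
      have hCpos : 0 < C.card := Finset.card_pos.2 ⟨i, hiC⟩
      obtain ⟨D, hDK, hDk, hD⟩ := ih (insert j (C.erase i)) (by
        rw [Finset.insert_sdiff_of_mem _ hjK, Finset.erase_sdiff_comm, Finset.card_erase_of_mem hi]
        omega) (by rw [Finset.card_insert_of_notMem hjE]; omega)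
      refine ⟨D, hDK, hDk, ?_⟩
      have e1 := value_insert_le (g := g) (S := S) (Finset.notMem_erase i C)
      rw [Finset.insert_erase hiC] at e1
      have e2 := le_value_insert (S := S) h0 h1 hjE
      have e3 := hlarge j hjK
      have e4 : (S j ∩ covered S (C.erase i)).card ≤ (S j ∩ covered S C).card := by
        refine Finset.card_le_card (Finset.inter_subset_inter_left fun u hu => ?_)
        obtain ⟨a, ha, hu⟩ := mem_covered.1 hu
        exact mem_covered.2 ⟨a, Finset.mem_of_mem_erase ha, hu⟩
      have e5 : value g S C ≤
          value g S (insert j (C.erase i)) + 2 * (S j ∩ covered S C).card := by omega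
      calc k * E * value g S C
          ≤ k * E * (value g S (insert j (C.erase i)) + 2 * (S j ∩ covered S C).card) := by gcongr
        _ = k * E * value g S (insert j (C.erase i)) + k * E * (2 * (S j ∩ covered S C).card) := by
            ring
        _ ≤ k * E * value g S D + s * O + O := by gcongr
        _ = _ := by ring
  obtain ⟨C, hCk, hC⟩ := exists_optimum k (value g S)
  obtain ⟨D, hDK, hDk, hD⟩ := key _ C rfl hCk
  refine ⟨D, hDK, hDk, ?_⟩
  rw [hC, ← hO] at hD
  have h2 : (C \ K).card ≤ k := (Finset.card_le_card Finset.sdiff_subset).trans hCk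
  have h3 : k * (E * O) ≤ k * (E * value g S D + O) := by
    calc k * (E * O) = k * E * O := by ring
      _ ≤ k * E * value g S D + (C \ K).card * O := hD
      _ ≤ k * E * value g S D + k * O := by gcongr
      _ = _ := by ring
  exact Nat.le_of_mul_le_mul_left h3 hk

end Values

/-! ### Pairwise independent sampling -/

section Hash

theorem card_filter_hash {q : ℕ} (hq : q.Prime) {u v : ℕ} (hu : u < q) (hv : v < q) (huv : u ≠ v)
    {A : Finset (ℕ × ℕ)} (hA : A ⊆ Finset.range q ×ˢ Finset.range q) :
    ((Finset.range (q * q)).filter fun d => (hash q d u, hash q d v) ∈ A).card = A.card := by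
  have hinj : Set.InjOn (fun d => (hash q d u, hash q d v)) (Finset.range (q * q)) := by
    intro d hd d' hd' h
    have : Fact q.Prime := ⟨hq⟩
    simp only [Prod.mk.injEq, hash] at h
    have h1 : ((d / q * u + d % q : ℕ) : ZMod q) = (d' / q * u + d' % q : ℕ) :=
      (ZMod.natCast_eq_natCast_iff _ _ _).2 h.1
    have h2 : ((d / q * v + d % q : ℕ) : ZMod q) = (d' / q * v + d' % q : ℕ) :=
      (ZMod.natCast_eq_natCast_iff _ _ _).2 h.2
    push_cast at h1 h2
    have huv' : (u : ZMod q) - v ≠ 0 := by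
      intro h0
      rw [sub_eq_zero, ZMod.natCast_eq_natCast_iff'] at h0
      rw [Nat.mod_eq_of_lt hu, Nat.mod_eq_of_lt hv] at h0
      exact huv h0
    have h3 : (((d / q : ℕ) : ZMod q) - (d' / q : ℕ)) * (u - v) = 0 := by
      linear_combination h1 - h2
    have h4 : ((d / q : ℕ) : ZMod q) = (d' / q : ℕ) :=
      sub_eq_zero.1 ((mul_eq_zero.1 h3).resolve_right huv')
    rw [h4] at h1
    have h5 : ((d % q : ℕ) : ZMod q) = (d' % q : ℕ) := by simpa using h1
    rw [ZMod.natCast_eq_natCast_iff'] at h4 h5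
    have hd1 : d < q * q := by simpa using hd
    have hd1' : d' < q * q := by simpa using hd'
    rw [Nat.mod_eq_of_lt (Nat.div_lt_of_lt_mul hd1),
      Nat.mod_eq_of_lt (Nat.div_lt_of_lt_mul hd1')] at h4
    rw [Nat.mod_mod, Nat.mod_mod] at h5
    rw [← Nat.div_add_mod d q, ← Nat.div_add_mod d' q, h4, h5]
  have himg : (Finset.range (q * q)).image (fun d => (hash q d u, hash q d v)) =
      Finset.range q ×ˢ Finset.range q := by
    refine Finset.eq_of_subset_of_card_le ?_ ?_
    · intro x hx
      obtain ⟨d, -, rfl⟩ := Finset.mem_image.1 hx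
      simp [hash, Nat.mod_lt _ hq.pos]
    · rw [Finset.card_image_of_injOn hinj]
      simp
  have h2 : ((Finset.range (q * q)).filter fun d => (hash q d u, hash q d v) ∈ A).image
      (fun d => (hash q d u, hash q d v)) = A := by
    ext x
    simp only [Finset.mem_image, Finset.mem_filter]
    constructor
    · rintro ⟨d, ⟨-, hd⟩, rfl⟩
      exact hd
    · intro hx
      have := hA hx
      rw [← himg, Finset.mem_image] at this
      obtain ⟨d, hd, rfl⟩ := this
      exact ⟨d, ⟨hd, hx⟩, rfl⟩
  conv_rhs => rw [← h2]
  refine (Finset.card_image_of_injOn (hinj.mono ?_)).symm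
  exact_mod_cast Finset.filter_subset _ _

variable {q t : ℕ}

theorem card_hash_lt (hq : q.Prime) (ht : t ≤ q) {u : ℕ} (hu : u < q) :
    ((Finset.range (q * q)).filter fun d => hash q d u < t).card = t * q := by
  obtain ⟨v, hv, huv⟩ : ∃ v, v < q ∧ u ≠ v := by
    rcases Nat.eq_zero_or_pos u with rfl | h
    · exact ⟨1, hq.one_lt, by omega⟩
    · exact ⟨0, hq.pos, by omega⟩
  have h := card_filter_hash hq hu hv huv (A := Finset.range t ×ˢ Finset.range q)
    (Finset.product_subset_product_left (by simpa using ht))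
  rw [Finset.card_product, Finset.card_range, Finset.card_range] at h
  rw [← h]
  congr 1
  refine Finset.filter_congr fun d _ => ?_
  simp [hash, Nat.mod_lt _ hq.pos]

theorem card_hash_lt_and (hq : q.Prime) (ht : t ≤ q) {u v : ℕ} (hu : u < q) (hv : v < q)
    (huv : u ≠ v) :
    ((Finset.range (q * q)).filter fun d => hash q d u < t ∧ hash q d v < t).card = t * t := by
  have h := card_filter_hash hq hu hv huv (A := Finset.range t ×ˢ Finset.range t)
    (Finset.product_subset_product (by simpa using ht) (by simpa using ht))
  rw [Finset.card_product, Finset.card_range] at h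
  rw [← h]
  congr 1
  refine Finset.filter_congr fun d _ => ?_
  simp

/-- Number of sampled elements of `V`. -/
def sampleCount {n : ℕ} (q t d : ℕ) (V : Finset (Fin n)) : ℕ :=
  (V.filter fun u => hash q d u.val < t).card

variable {n : ℕ}

theorem sum_sampleCount (hq : q.Prime) (ht : t ≤ q) (hn : n ≤ q) (V : Finset (Fin n)) :
    ∑ d ∈ Finset.range (q * q), sampleCount q t d V = V.card * (t * q) := by
  simp_rw [sampleCount, Finset.card_filter]
  rw [Finset.sum_comm]
  simp_rw [← Finset.card_filter]
  rw [Finset.sum_congr rfl fun u _ => card_hash_lt hq ht (u.2.trans_le hn)]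
  simp

theorem sum_sampleCount_sq (hq : q.Prime) (ht : t ≤ q) (hn : n ≤ q) (V : Finset (Fin n)) :
    ∑ d ∈ Finset.range (q * q), (sampleCount q t d V : ℤ) ^ 2 =
      V.card * (t * q) + V.card * (V.card - 1) * (t * t) := by
  have h1 : ∀ d, (sampleCount q t d V : ℤ) ^ 2 =
      ∑ u ∈ V, ∑ v ∈ V, if hash q d u.val < t ∧ hash q d v.val < t then (1 : ℤ) else 0 := by
    intro d
    rw [sampleCount, Finset.card_filter, sq]
    push_cast
    rw [Finset.sum_mul_sum]
    refine Finset.sum_congr rfl fun u _ => Finset.sum_congr rfl fun v _ => ?_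
    by_cases h : hash q d u.val < t <;> by_cases h' : hash q d v.val < t <;> simp [h, h']
  simp_rw [h1]
  rw [Finset.sum_comm]
  have h2 : ∀ u ∈ V, ∑ d ∈ Finset.range (q * q), ∑ v ∈ V,
      (if hash q d u.val < t ∧ hash q d v.val < t then (1 : ℤ) else 0) =
      t * q + (V.card - 1) * (t * t) := by
    intro u hu
    rw [Finset.sum_comm, ← Finset.add_sum_erase _ _ hu]
    congr 1
    · simp only [and_self]
      rw [← Finset.natCast_card_filter, card_hash_lt hq ht (u.2.trans_le hn)]
      push_cast
      rfl
    · have : ∀ v ∈ V.erase u, ∑ d ∈ Finset.range (q * q),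
          (if hash q d u.val < t ∧ hash q d v.val < t then (1 : ℤ) else 0) = t * t := by
        intro v hv
        rw [← Finset.natCast_card_filter, card_hash_lt_and hq ht (u.2.trans_le hn)
          (v.2.trans_le hn) (fun h => (Finset.mem_erase.1 hv).1 (Fin.ext h).symm)]
        push_cast
        rfl
      rw [Finset.sum_congr rfl this, Finset.sum_const, Finset.card_erase_of_mem hu, nsmul_eq_mul,
        Nat.cast_sub (Finset.card_pos.2 ⟨u, hu⟩)]
      push_cast
      rfl
  rw [Finset.sum_congr rfl h2, Finset.sum_const, nsmul_eq_mul]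
  ring

theorem sum_deviation_sq (hq : q.Prime) (ht : t ≤ q) (hn : n ≤ q) (V : Finset (Fin n)) :
    ∑ d ∈ Finset.range (q * q), ((q : ℤ) * sampleCount q t d V - t * V.card) ^ 2 =
      q ^ 2 * t * V.card * (q - t) := by
  have h1 : ∀ d, ((q : ℤ) * sampleCount q t d V - t * V.card) ^ 2 =
      q ^ 2 * (sampleCount q t d V : ℤ) ^ 2 - 2 * q * t * V.card * sampleCount q t d V
        + (t * V.card) ^ 2 := fun d => by ring
  simp_rw [h1]
  have h2 : ∑ d ∈ Finset.range (q * q), (sampleCount q t d V : ℤ) = V.card * (t * q) := by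
    exact_mod_cast sum_sampleCount hq ht hn V
  rw [Finset.sum_add_distrib, Finset.sum_sub_distrib, ← Finset.mul_sum, ← Finset.mul_sum,
    sum_sampleCount_sq hq ht hn, h2, Finset.sum_const, Finset.card_range, nsmul_eq_mul]
  push_cast
  ring

/-- The seeds for which some set of `D` has too many sampled elements, or the sampled value of `D`
deviates too much from its expectation. -/
def badSeeds {m : ℕ} (g : ℕ → Bool) (S : Fin m → Finset (Fin n)) (q t c E O : ℕ)
    (D : Finset (Fin m)) : Finset ℕ :=
  (Finset.range (q * q)).filter fun d => (∃ i ∈ D, c < sampleCount q t d (S i)) ∨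
    (t * O : ℤ) < E * |(q : ℤ) * sampleCount q t d (valueSet g S D) - t * value g S D|

theorem card_badSeeds_le {m : ℕ} {g : ℕ → Bool} {S : Fin m → Finset (Fin n)} {M k E O j : ℕ}
    (hq : q.Prime) (hn : n ≤ q) (hk : 0 < k) {D : Finset (Fin m)} (hD : D.card ≤ k)
    (hM : ∀ i, (S i).card ≤ M) (hMn : M ≤ n) (hMj : M < 2 ^ (j + 1)) (hjM : 2 ^ j ≤ M)
    (hMO : M ≤ O) (hDO : value g S D ≤ O)
    (ht : t = min q (q * (32 * E ^ 2) / 2 ^ j + 1)) :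
    16 * (badSeeds g S q t (32 * k * (64 * E ^ 2 + 1)) E O D).card ≤ q * q := by
  have htq : t ≤ q := ht ▸ min_le_left _ _
  have hMpos : 0 < M := lt_of_lt_of_le (by positivity) hjM
  have htpos : 0 < t := by
    rw [ht]
    exact lt_min hq.pos (Nat.succ_pos _)
  have hsub : badSeeds g S q t (32 * k * (64 * E ^ 2 + 1)) E O D ⊆
      (D.biUnion fun i => (Finset.range (q * q)).filter fun d =>
        32 * k * (64 * E ^ 2 + 1) < sampleCount q t d (S i)) ∪
      (Finset.range (q * q)).filter fun d => (t * O : ℤ) <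
        E * |(q : ℤ) * sampleCount q t d (valueSet g S D) - t * value g S D| := by
    intro d hd
    rw [badSeeds, Finset.mem_filter] at hd
    simp only [Finset.mem_union, Finset.mem_biUnion, Finset.mem_filter]
    rcases hd with ⟨hd, ⟨i, hi, h⟩ | h⟩
    · exact Or.inl ⟨i, hi, hd, h⟩
    · exact Or.inr ⟨hd, h⟩
  have htM : t * M ≤ (64 * E ^ 2 + 1) * q := by
    have h1 : t ≤ q * (32 * E ^ 2) / 2 ^ j + 1 := ht ▸ min_le_right _ _
    have h2 : q * (32 * E ^ 2) / 2 ^ j * 2 ^ j ≤ q * (32 * E ^ 2) := Nat.div_mul_le_self _ _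
    calc t * M ≤ (q * (32 * E ^ 2) / 2 ^ j + 1) * M := by gcongr
      _ = q * (32 * E ^ 2) / 2 ^ j * M + M := by ring
      _ ≤ q * (32 * E ^ 2) / 2 ^ j * 2 ^ (j + 1) + q := by
          gcongr
          exact hMn.trans hn
      _ = q * (32 * E ^ 2) / 2 ^ j * 2 ^ j * 2 + q := by ring
      _ ≤ q * (32 * E ^ 2) * 2 + q := by gcongr
      _ = _ := by ring
  have hA : ∀ i, 32 * k * ((Finset.range (q * q)).filter fun d =>
      32 * k * (64 * E ^ 2 + 1) < sampleCount q t d (S i)).card ≤ q * q := by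
    intro i
    have h1 : ((Finset.range (q * q)).filter fun d =>
        32 * k * (64 * E ^ 2 + 1) < sampleCount q t d (S i)).card * (32 * k * (64 * E ^ 2 + 1)) ≤
        (S i).card * (t * q) := by
      rw [← sum_sampleCount hq htq hn (S i), ← smul_eq_mul]
      refine (Finset.card_nsmul_le_sum _ (fun d => sampleCount q t d (S i)) _ ?_).trans
        (Finset.sum_le_sum_of_subset (Finset.filter_subset _ _))
      intro d hd
      exact (Finset.mem_filter.1 hd).2.le
    have h2 : (S i).card * (t * q) ≤ (64 * E ^ 2 + 1) * (q * q) := by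
      calc (S i).card * (t * q) ≤ M * (t * q) := by gcongr; exact hM i
        _ = t * M * q := by ring
        _ ≤ (64 * E ^ 2 + 1) * q * q := by gcongr
        _ = _ := by ring
    refine Nat.le_of_mul_le_mul_left ?_ (Nat.succ_pos (64 * E ^ 2))
    refine le_trans (le_of_eq ?_) (h1.trans h2)
    simp only [Nat.succ_eq_add_one]
    ring
  have hA' : 32 * (D.biUnion fun i => (Finset.range (q * q)).filter fun d =>
        32 * k * (64 * E ^ 2 + 1) < sampleCount q t d (S i)).card ≤ q * q := by
    refine Nat.le_of_mul_le_mul_left ?_ hk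
    calc k * (32 * (D.biUnion fun i => (Finset.range (q * q)).filter fun d =>
        32 * k * (64 * E ^ 2 + 1) < sampleCount q t d (S i)).card)
        ≤ k * (32 * ∑ i ∈ D, ((Finset.range (q * q)).filter fun d =>
          32 * k * (64 * E ^ 2 + 1) < sampleCount q t d (S i)).card) := by
          gcongr
          exact Finset.card_biUnion_le
      _ = ∑ i ∈ D, 32 * k * ((Finset.range (q * q)).filter fun d =>
          32 * k * (64 * E ^ 2 + 1) < sampleCount q t d (S i)).card := by
          rw [Finset.mul_sum, Finset.mul_sum]
          exact Finset.sum_congr rfl fun _ _ => by ring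
      _ ≤ D.card * (q * q) := by
          rw [← smul_eq_mul]
          exact Finset.sum_le_card_nsmul _ _ _ fun i _ => hA i
      _ ≤ k * (q * q) := by gcongr
  have hB : 32 * ((Finset.range (q * q)).filter fun d => (t * O : ℤ) <
      E * |(q : ℤ) * sampleCount q t d (valueSet g S D) - t * value g S D|).card ≤ q * q := by
    set F := (Finset.range (q * q)).filter fun d => (t * O : ℤ) <
      E * |(q : ℤ) * sampleCount q t d (valueSet g S D) - t * value g S D| with hF
    have h1 : (F.card : ℤ) * ((t * O) ^ 2) ≤
        E ^ 2 * (q ^ 2 * t * (valueSet g S D).card * (q - t)) := by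
      rw [← sum_deviation_sq hq htq hn, Finset.mul_sum, ← nsmul_eq_mul]
      refine (Finset.card_nsmul_le_sum F (fun d => (E : ℤ) ^ 2 *
        ((q : ℤ) * sampleCount q t d (valueSet g S D) - t * (valueSet g S D).card) ^ 2) _ ?_).trans
        (Finset.sum_le_sum_of_subset_of_nonneg (Finset.filter_subset _ _)
          fun _ _ _ => by positivity)
      intro d hd
      have h := (Finset.mem_filter.1 hd).2
      have h' := pow_le_pow_left₀ (by positivity) h.le 2
      rw [mul_pow, mul_pow (E : ℤ), sq_abs, ← mul_pow] at h'
      exact h'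
    have h2 : (32 * E ^ 2 * (q - t) : ℤ) ≤ t * O := by
      rcases le_or_gt q (q * (32 * E ^ 2) / 2 ^ j + 1) with h | h
      · rw [min_eq_left h] at ht
        rw [ht, sub_self, mul_zero]
        positivity
      · rw [min_eq_right h.le] at ht
        have h3 : q * (32 * E ^ 2) < 2 ^ j * t := by
          rw [ht]
          exact Nat.lt_mul_div_succ _ (by positivity)
        have h4 : q * (32 * E ^ 2) ≤ t * O := by
          calc q * (32 * E ^ 2) ≤ 2 ^ j * t := h3.le
            _ ≤ O * t := by gcongr; exact hjM.trans hMO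
            _ = _ := mul_comm _ _
        have h5 : (q * (32 * E ^ 2) : ℤ) ≤ t * O := by exact_mod_cast h4
        have h6 : (0 : ℤ) ≤ 32 * E ^ 2 * t := by positivity
        linarith
    have h3 : ((valueSet g S D).card : ℤ) ≤ O := by exact_mod_cast hDO
    have hOpos : (0 : ℤ) < t * O := by
      have : 0 < O := hMpos.trans_le hMO
      positivity
    have htq' : (0 : ℤ) ≤ q - t := by
      have : (t : ℤ) ≤ q := by exact_mod_cast htq
      linarith
    have h4 : (32 * F.card : ℤ) * ((t * O) * (t * O)) ≤ (q * q) * ((t * O) * (t * O)) := by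
      calc (32 * F.card : ℤ) * ((t * O) * (t * O)) = 32 * (F.card * (t * O) ^ 2) := by ring
        _ ≤ 32 * (E ^ 2 * (q ^ 2 * t * (valueSet g S D).card * (q - t))) := by gcongr
        _ ≤ 32 * (E ^ 2 * (q ^ 2 * t * O * (q - t))) := by gcongr
        _ = q * q * (t * O) * (32 * E ^ 2 * (q - t)) := by ring
        _ ≤ q * q * (t * O) * (t * O) := by gcongr
        _ = _ := by ring
    exact_mod_cast le_of_mul_le_mul_right h4 (by positivity)
  have := (Finset.card_le_card hsub).trans (Finset.card_union_le _ _)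
  omega

end Hash

/-! ### Majority of independent samples -/

section Majority

theorem sum_prod_digit (Q L : ℕ) (c : ℕ → ℕ) :
    ∑ ω ∈ Finset.range (Q ^ L), ∏ l ∈ Finset.range L, c (digit Q ω l) =
      (∑ x ∈ Finset.range Q, c x) ^ L := by
  have h : (∑ x : Fin Q, c x) ^ L = ∏ _l : Fin L, ∑ x ∈ (Finset.univ : Finset (Fin Q)), c x := by
    simp
  rw [Finset.sum_range, Finset.sum_range, h, Finset.prod_univ_sum,
    Fintype.piFinset_univ, ← Equiv.sum_comp finFunctionFinEquiv.symm]
  refine Finset.sum_congr rfl fun ω _ => ?_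
  rw [Finset.prod_range]
  rfl

theorem card_majority_le {Q L : ℕ} {B : Finset ℕ} (hB : B ⊆ Finset.range Q)
    (hcard : 16 * B.card ≤ Q) :
    ((Finset.range (Q ^ L)).filter fun ω =>
      L ≤ 2 * ((Finset.range L).filter fun l => digit Q ω l ∈ B).card).card * 2 ^ L ≤ Q ^ L := by
  have h1 := sum_prod_digit Q L fun x => if x ∈ B then 16 else 1
  have h2 : ∑ x ∈ Finset.range Q, (if x ∈ B then 16 else 1) ≤ 2 * Q := by
    calc ∑ x ∈ Finset.range Q, (if x ∈ B then 16 else 1)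
        ≤ ∑ x ∈ Finset.range Q, (1 + if x ∈ B then 16 else 0) := by
          refine Finset.sum_le_sum fun x _ => ?_
          split_ifs <;> norm_num
      _ = Q + B.card * 16 := by
          rw [Finset.sum_add_distrib, ← Finset.sum_filter, Finset.filter_mem_eq_inter,
            Finset.inter_eq_right.2 hB]
          simp
      _ ≤ 2 * Q := by omega
  have h3 : ((Finset.range (Q ^ L)).filter fun ω =>
      L ≤ 2 * ((Finset.range L).filter fun l => digit Q ω l ∈ B).card).card * 4 ^ L ≤
      (2 * Q) ^ L := by
    refine le_trans ?_ (h1.le.trans (Nat.pow_le_pow_left h2 L))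
    rw [← smul_eq_mul]
    refine (Finset.card_nsmul_le_sum _ (fun ω => ∏ l ∈ Finset.range L,
      if digit Q ω l ∈ B then 16 else 1) _ ?_).trans
      (Finset.sum_le_sum_of_subset (Finset.filter_subset _ _))
    intro ω hω
    rw [Finset.prod_ite, Finset.prod_const, Finset.prod_const_one, mul_one,
      show (16 : ℕ) = 4 ^ 2 by norm_num, ← pow_mul]
    exact Nat.pow_le_pow_right (by norm_num) (Finset.mem_filter.1 hω).2
  refine Nat.le_of_mul_le_mul_left ?_ (show 0 < 2 ^ L by positivity)
  calc _ = ((Finset.range (Q ^ L)).filter fun ω => L ≤ 2 * ((Finset.range L).filter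
        fun l => digit Q ω l ∈ B).card).card * 4 ^ L := by
        rw [show (4 : ℕ) = 2 * 2 by norm_num, mul_pow]
        ring
    _ ≤ (2 * Q) ^ L := h3
    _ = _ := mul_pow _ _ _

theorem card_small_subsets_le (m k : ℕ) :
    (Finset.univ.filter fun D : Finset (Fin m) => D.card ≤ k).card ≤ (m + 1) ^ k := by
  calc (Finset.univ.filter fun D : Finset (Fin m) => D.card ≤ k).card
      ≤ ((Finset.range (k + 1)).biUnion fun i =>
          Finset.powersetCard i (Finset.univ : Finset (Fin m))).card := by
        refine Finset.card_le_card fun D hD => ?_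
        simp only [Finset.mem_biUnion, Finset.mem_powersetCard, Finset.mem_range]
        exact ⟨D.card, Nat.lt_succ_of_le (Finset.mem_filter.1 hD).2, Finset.subset_univ _, rfl⟩
    _ ≤ ∑ i ∈ Finset.range (k + 1), m.choose i := by
        refine Finset.card_biUnion_le.trans (le_of_eq ?_)
        simp [Finset.card_powersetCard]
    _ ≤ ∑ i ∈ Finset.range (k + 1), m ^ i * 1 ^ (k - i) * k.choose i := by
        refine Finset.sum_le_sum fun i hi => ?_
        have h : 0 < k.choose i := Nat.choose_pos (Nat.lt_succ_iff.1 (Finset.mem_range.1 hi))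
        rw [one_pow, mul_one]
        exact (Nat.choose_le_pow m i).trans (Nat.le_mul_of_pos_right _ h)
    _ = (m + 1) ^ k := (add_pow _ _ _).symm

end Majority

/-! ### The encoding of states -/

section Encoding

theorem encodeList_pos {B : ℕ} (hB : 2 ≤ B) (l : List ℕ) : 0 < encodeList B l := by
  induction l with
  | nil => simp [encodeList]
  | cons d l ih =>
    have : encodeList B (d :: l) = d + B * encodeList B l := rfl
    have : 0 < B * encodeList B l := by positivity
    omega

theorem decodeList_encodeList {B : ℕ} (hB : 2 ≤ B) {l : List ℕ} (hl : ∀ d ∈ l, d < B) :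
    decodeList B (encodeList B l) = l := by
  induction l with
  | nil => simp [encodeList, decodeList]
  | cons d l ih =>
    have hd : d < B := hl d (by simp)
    have hpos := encodeList_pos hB l
    have hdiv : (d + B * encodeList B l) / B = encodeList B l := by
      rw [Nat.add_mul_div_left _ _ (by omega), Nat.div_eq_of_lt hd, zero_add]
    have hlog : Nat.log B (d + B * encodeList B l) = Nat.log B (encodeList B l) + 1 := by
      rw [Nat.log_of_one_lt_of_le (by omega), hdiv]
      nlinarith
    have ih' := ih fun d hd => hl d (by simp [hd])
    change decodeList B (d + B * encodeList B l) = _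
    unfold decodeList at ih' ⊢
    rw [hlog, List.range_succ_eq_map, List.map_cons, List.map_map]
    congr 1
    · simp [Nat.mod_eq_of_lt hd]
    · conv_rhs => rw [← ih']
      refine List.map_congr_left fun i _ => ?_
      simp only [Function.comp_apply, Nat.succ_eq_add_one]
      rw [pow_succ', ← Nat.div_div_eq_div_mul, hdiv]

theorem encodeList_lt {B : ℕ} {l : List ℕ} (hl : ∀ d ∈ l, d < B) :
    encodeList B l < 2 * B ^ l.length := by
  induction l with
  | nil => simp [encodeList]
  | cons d l ih =>
    have hd : d < B := hl d (by simp)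
    have ih' := ih fun d hd => hl d (by simp [hd])
    change d + B * encodeList B l < _
    rw [List.length_cons, pow_succ]
    calc d + B * encodeList B l < B * (encodeList B l + 1) := by rw [mul_add]; omega
      _ ≤ B * (2 * B ^ l.length) := by gcongr; exact ih'
      _ = _ := by ring

theorem size_encodeList_le {B : ℕ} {l : List ℕ} (hl : ∀ d ∈ l, d < B) :
    Nat.size (encodeList B l) ≤ l.length * Nat.size B + 1 := by
  rw [Nat.size_le]
  calc encodeList B l < 2 * B ^ l.length := encodeList_lt hl
    _ ≤ 2 * (2 ^ Nat.size B) ^ l.length := by gcongr; exact (Nat.lt_size_self B).le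
    _ = _ := by rw [← pow_mul, pow_succ, mul_comm, mul_comm l.length]

theorem size_pair_le (a b : ℕ) : Nat.size (Nat.pair a b) ≤ 2 * (Nat.size a + Nat.size b) := by
  rw [Nat.size_le]
  refine (Nat.pair_lt_max_add_one_sq a b).trans_le ?_
  rw [mul_comm, pow_mul]
  refine Nat.pow_le_pow_left ?_ 2
  rw [Nat.succ_le_iff, max_lt_iff]
  exact ⟨(Nat.lt_size_self a).trans_le (Nat.pow_le_pow_right (by norm_num) (by omega)),
    (Nat.lt_size_self b).trans_le (Nat.pow_le_pow_right (by norm_num) (by omega))⟩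

theorem pair_lt_sq {a b Z : ℕ} (ha : a < Z) (hb : b < Z) : Nat.pair a b < Z ^ 2 :=
  (Nat.pair_lt_max_add_one_sq a b).trans_le
    (Nat.pow_le_pow_left (Nat.succ_le_of_lt (max_lt ha hb)) 2)

/-- All entries of the lists of the state are less than `Z`. -/
def Bounded (Z : ℕ) (s : State) : Prop :=
  (∀ e ∈ s.2.2.2.1, e.1 < Z ∧ e.2 < Z) ∧ ∀ e ∈ s.2.2.2.2, e.1 < Z ∧ e.2.1 < Z ∧ e.2.2 < Z

theorem Bounded.sizes_lt {Z : ℕ} {s : State} (h : Bounded Z s) :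
    ∀ d ∈ s.2.2.2.1.map (fun e => Nat.pair e.1 e.2), d < Z ^ 4 := by
  intro d hd
  obtain ⟨e, he, rfl⟩ := List.mem_map.1 hd
  obtain ⟨h1, h2⟩ := h.1 e he
  exact (pair_lt_sq h1 h2).trans_le (Nat.pow_le_pow_right (by omega) (by norm_num))

theorem Bounded.recs_lt {Z : ℕ} {s : State} (h : Bounded Z s) :
    ∀ d ∈ s.2.2.2.2.map (fun e => Nat.pair e.1 (Nat.pair e.2.1 e.2.2)), d < Z ^ 4 := by
  intro d hd
  obtain ⟨e, he, rfl⟩ := List.mem_map.1 hd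
  obtain ⟨h1, h2, h3⟩ := h.2 e he
  have h4 : e.1 < Z ^ 2 := h1.trans_le (Nat.le_self_pow (by norm_num) Z)
  rw [show Z ^ 4 = (Z ^ 2) ^ 2 by ring]
  exact pair_lt_sq h4 (pair_lt_sq h2 h3)

theorem unpack_pack {Z : ℕ} (hZ : 2 ≤ Z) {s : State} (h : Bounded Z s) :
    unpack (Z ^ 4) (pack (Z ^ 4) s) = s := by
  have hB : 2 ≤ Z ^ 4 := hZ.trans (Nat.le_self_pow (by norm_num) Z)
  have h1 := decodeList_encodeList hB h.sizes_lt
  have h2 := decodeList_encodeList hB h.recs_lt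
  simp only [unpack, pack, Nat.unpair_pair, h1, h2, List.map_map]
  simp [Function.comp_def]

theorem size_pack_le {Z : ℕ} {s : State} (h : Bounded Z s) :
    Nat.size (pack (Z ^ 4) s) ≤ 16 * (Nat.size s.1 + Nat.size s.2.1 + Nat.size s.2.2.1 + 2 +
      (s.2.2.2.1.length + s.2.2.2.2.length) * Nat.size (Z ^ 4)) := by
  have h1 := size_encodeList_le h.sizes_lt
  have h2 := size_encodeList_le h.recs_lt
  rw [List.length_map] at h1 h2
  rw [add_mul]
  refine (size_pair_le _ _).trans ?_
  have e1 := size_pair_le s.2.1 (Nat.pair s.2.2.1 (Nat.pair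
    (encodeList (Z ^ 4) (s.2.2.2.1.map fun e => Nat.pair e.1 e.2))
    (encodeList (Z ^ 4) (s.2.2.2.2.map fun e => Nat.pair e.1 (Nat.pair e.2.1 e.2.2)))))
  have e2 := size_pair_le s.2.2.1 (Nat.pair
    (encodeList (Z ^ 4) (s.2.2.2.1.map fun e => Nat.pair e.1 e.2))
    (encodeList (Z ^ 4) (s.2.2.2.2.map fun e => Nat.pair e.1 (Nat.pair e.2.1 e.2.2))))
  have e3 := size_pair_le
    (encodeList (Z ^ 4) (s.2.2.2.1.map fun e => Nat.pair e.1 e.2))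
    (encodeList (Z ^ 4) (s.2.2.2.2.map fun e => Nat.pair e.1 (Nat.pair e.2.1 e.2.2)))
  omega

end Encoding

/-! ### Auxiliary facts on lists -/

section Lists

theorem pick_spec {α : Type*} (f : α → ℕ) (l : List α) :
    ∀ d : α, pick f d l ∈ d :: l ∧ ∀ x ∈ d :: l, f x ≤ f (pick f d l) := by
  induction l with
  | nil => intro d; simp [pick]
  | cons y l ih =>
    intro d
    have hp : pick f d (y :: l) = pick f (bif decide (f d < f y) then y else d) l := rfl
    by_cases h : f d < f y
    · simp only [h, decide_true, cond_true] at hp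
      rw [hp]
      obtain ⟨h1, h2⟩ := ih y
      refine ⟨List.mem_cons_of_mem _ h1, fun x hx => ?_⟩
      rcases List.mem_cons.1 hx with rfl | hx
      · exact h.le.trans (h2 y (by simp))
      · exact h2 x hx
    · simp only [h, decide_false, cond_false] at hp
      rw [hp]
      obtain ⟨h1, h2⟩ := ih d
      refine ⟨?_, fun x hx => ?_⟩
      · rcases List.mem_cons.1 h1 with h1 | h1
        · simp [h1]
        · simp [h1]
      · rcases List.mem_cons.1 hx with rfl | hx
        · exact h2 x (by simp)
        · rcases List.mem_cons.1 hx with rfl | hx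
          · exact (not_lt.1 h).trans (h2 d (by simp))
          · exact h2 x (by simp [hx])

theorem mem_subs {α : Type*} {l s : List α} : s ∈ subs l ↔ s.Sublist l := by
  induction l generalizing s with
  | nil => simp [subs]
  | cons x l ih =>
    have : subs (x :: l) = subs l ++ (subs l).map fun y => x :: y := rfl
    rw [this, List.mem_append, List.mem_map, List.sublist_cons_iff]
    simp only [ih]
    constructor
    · rintro (h | ⟨a, h, rfl⟩)
      · exact Or.inl h
      · exact Or.inr ⟨a, rfl, h⟩
    · rintro (h | ⟨a, rfl, h⟩)
      · exact Or.inl h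
      · exact Or.inr ⟨a, h, rfl⟩

theorem length_le_of_filter_le {α κ : Type*} [DecidableEq κ] (f : α → κ) (K : Finset κ) (c : ℕ)
    (l : List α) (hK : ∀ e ∈ l, f e ∈ K)
    (hc : ∀ x ∈ K, (l.filter fun e => decide (f e = x)).length ≤ c) : l.length ≤ K.card * c := by
  have h : l.length = ∑ x ∈ K, (l.filter fun e => decide (f e = x)).length := by
    clear hc
    induction l with
    | nil => simp
    | cons e l ih =>
      have h1 : ∀ x, ((e :: l).filter fun e => decide (f e = x)).length =
          (if f e = x then 1 else 0) + (l.filter fun e => decide (f e = x)).length := by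
        intro x
        by_cases h : f e = x
        · simp [h, add_comm]
        · simp [h]
      simp_rw [h1]
      rw [Finset.sum_add_distrib, ← ih fun e he => hK e (by simp [he]), Finset.sum_ite_eq,
        if_pos (hK e (by simp)), List.length_cons, add_comm]
  rw [h, ← smul_eq_mul]
  exact Finset.sum_le_card_nsmul _ _ _ hc

end Lists

/-! ### The states of the algorithm on a stream -/

section Run

/-- The stream of the sets `W 0, …, W (i - 1)`. -/
def blocks (W : ℕ → List ℕ) (i : ℕ) : List (Option ℕ) :=
  (List.range i).flatMap fun j => (W j).map some ++ [none]

/-- The elements known of the set `a` when the sets listed in `sizes` are kept, the current set is `i`,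
and the elements `v` of it have been read. -/
def known (W : ℕ → List ℕ) (sizes : List (ℕ × ℕ)) (i : ℕ) (v : List ℕ) (a : ℕ) : List ℕ :=
  if a = i then v else if a ∈ sizes.map Prod.fst then W a else []

/-- The state after the sets `W 0, …, W (i - 1)` and the elements `v` of the next one. -/
structure Inv (γ : ℕ) (p : Params) (W : ℕ → List ℕ) (ω i : ℕ) (v : List ℕ) (s : State) :
    Prop where
  seed : s.1 = ω
  pos : s.2.1 = i
  size : s.2.2.1 = v.length
  nodup : (s.2.2.2.1.map Prod.fst).Nodup
  mem : ∀ e ∈ s.2.2.2.1, e.1 < i ∧ e.2 = (W e.1).length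
  length_le : s.2.2.2.1.length ≤ width p
  dropped : ∀ a < i, a ∉ s.2.2.2.1.map Prod.fst →
    s.2.2.2.1.length = width p ∧ ∀ e ∈ s.2.2.2.1, (W a).length ≤ e.2
  recs : ∀ a x, s.2.2.2.2.filter (fun e => decide (e.1 = a) && decide (e.2.1 = x)) =
    if x < levels p * reps γ p then (((known W s.2.2.2.1 i v a).filter
      fun u => sampled γ p ω x u).take (cap p)).map fun u => (a, x, u) else []

variable {γ : ℕ} {p : Params} {W : ℕ → List ℕ} {ω i : ℕ} {v : List ℕ} {s : State}

theorem Inv.start (γ : ℕ) (p : Params) (W : ℕ → List ℕ) (ω : ℕ) :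
    Inv γ p W ω 0 [] (ω, 0, 0, [], []) where
  seed := rfl
  pos := rfl
  size := rfl
  nodup := by simp
  mem := by simp
  length_le := by simp
  dropped := by simp
  recs := by simp [known]

theorem Inv.load_eq (h : Inv γ p W ω i v s) {x : ℕ} (hx : x < levels p * reps γ p) :
    load s.2.2.2.2 i x = min (cap p) (v.filter fun u => sampled γ p ω x u).length := by
  rw [load, h.recs, if_pos hx, List.length_map, List.length_take, known, if_pos rfl]

theorem filter_map_range (P : ℕ → Bool) (N a i x u : ℕ) :
    ((((List.range N).filter P).map fun x => (i, x, u)).filter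
      fun e => decide (e.1 = a) && decide (e.2.1 = x)) =
    if i = a ∧ x < N ∧ P x = true then [(i, x, u)] else [] := by
  rw [List.filter_map, List.filter_filter]
  have h : ∀ y, (((fun e : ℕ × ℕ × ℕ => decide (e.1 = a) && decide (e.2.1 = x)) ∘
      fun x => (i, x, u)) y && P y) = ((decide (i = a) && P x) && (decide (y = x))) := by
    intro y
    by_cases hy : y = x
    · subst hy
      simp
    · simp [hy]
  rw [List.filter_congr fun y _ => h y]
  by_cases hc : (decide (i = a) && P x) = true
  · simp only [hc, Bool.true_and]
    have h2 : (List.range N).filter (fun y => decide (y = x)) = if x < N then [x] else [] := by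
      induction N with
      | zero => simp
      | succ N ih =>
        rw [List.range_succ, List.filter_append, ih]
        rcases lt_trichotomy x N with h | h | h
        · simp [h, h.trans (Nat.lt_succ_self N), h.ne']
        · simp [h]
        · simp [h.ne, Nat.not_lt.2 h.le, Nat.not_lt.2 (Nat.succ_le_of_lt h)]
    rw [h2]
    simp only [Bool.and_eq_true, decide_eq_true_eq] at hc
    by_cases hx : x < N <;> simp [hc, hx]
  · have hc' : (decide (i = a) && P x) = false := by simpa using hc
    simp only [hc', Bool.false_and]
    simp only [Bool.and_eq_true, decide_eq_true_eq, not_and] at hc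
    rw [if_neg fun h => hc h.1 h.2.2]
    simp

theorem Inv.addElement (h : Inv γ p W ω i v s) (u : ℕ) :
    Inv γ p W ω i (v ++ [u]) (addElement γ p s u) where
  seed := h.seed
  pos := h.pos
  size := by simp [StreamCoverage.addElement, h.size]
  nodup := h.nodup
  mem := h.mem
  length_le := h.length_le
  dropped := h.dropped
  recs := by
    intro a x
    simp only [StreamCoverage.addElement]
    rw [List.filter_append, filter_map_range, h.recs, h.pos, h.seed]
    by_cases hx : x < levels p * reps γ p
    · rw [if_pos hx, if_pos hx]
      by_cases ha : i = a
      · subst ha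
        have hk : ∀ v, known W s.2.2.2.1 i v i = v := fun v => if_pos rfl
        rw [hk, hk, List.filter_append]
        by_cases hu : sampled γ p ω x u = true
        · simp only [hu, hx, true_and, Bool.true_and, decide_eq_true_eq, h.load_eq hx,
            List.filter_cons_of_pos, List.filter_nil]
          set V := v.filter fun u => sampled γ p ω x u
          by_cases hV : V.length < cap p
          · rw [if_pos (by omega), List.take_of_length_le hV.le, List.take_of_length_le (by simp; omega)]
            simp
          · rw [if_neg (by omega), List.take_append_of_le_length (by omega)]
            simp
        · simp [hu]
      · rw [if_neg fun h => ha h.1]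
        have hk : ∀ v v', known W s.2.2.2.1 i v a = known W s.2.2.2.1 i v' a := fun v v' => by
          simp [known, Ne.symm ha]
        rw [hk v (v ++ [u]), List.append_nil]
    · simp [hx]

theorem Inv.fst_lt (h : Inv γ p W ω i v s) {a : ℕ} (ha : a ∈ s.2.2.2.1.map Prod.fst) : a < i := by
  obtain ⟨e, he, rfl⟩ := List.mem_map.1 ha
  exact (h.mem e he).1

theorem Inv.mem_cons (h : Inv γ p W ω i (W i) s) {e : ℕ × ℕ}
    (he : e ∈ (s.2.1, s.2.2.1) :: s.2.2.2.1) : e.1 < i + 1 ∧ e.2 = (W e.1).length := by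
  rcases List.mem_cons.1 he with rfl | he
  · exact ⟨by simp [h.pos], by simp [h.pos, h.size]⟩
  · exact ⟨(h.mem e he).1.trans (Nat.lt_succ_self i), (h.mem e he).2⟩

theorem Inv.nodup_cons (h : Inv γ p W ω i (W i) s) :
    (((s.2.1, s.2.2.1) :: s.2.2.2.1).map Prod.fst).Nodup := by
  rw [List.map_cons, List.nodup_cons]
  exact ⟨fun hc => (h.fst_lt hc).ne h.pos, h.nodup⟩

theorem Inv.closeSet (h : Inv γ p W ω i (W i) s) (hW : ∀ j, (W j).length ≤ p.1) :
    Inv γ p W ω (i + 1) [] (closeSet p s) := by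
  by_cases hw : s.2.2.2.1.length < width p
  · simp only [StreamCoverage.closeSet, hw, decide_true, cond_true]
    refine ⟨h.seed, by simp [h.pos], rfl, h.nodup_cons, fun e he => h.mem_cons he, ?_, ?_, ?_⟩
    · simpa using hw
    · intro a ha hna
      simp only [List.map_cons, List.mem_cons, not_or, h.pos] at hna
      exact absurd (h.dropped a (by omega) hna.2).1 hw.ne
    · intro a x
      simp only [h.recs, h.pos]
      have : known W s.2.2.2.1 i (W i) a = known W ((i, s.2.2.1) :: s.2.2.2.1) (i + 1) [] a := by
        unfold known
        simp only [List.map_cons, List.mem_cons]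
        by_cases h1 : a = i
        · subst h1
          simp
        · by_cases h2 : a = i + 1
          · have : a ∉ s.2.2.2.1.map Prod.fst := fun hc => by have := h.fst_lt hc; omega
            rw [if_neg h1, if_neg this, if_pos h2]
          · rw [if_neg h1, if_neg h2]
            exact if_congr (by simp [h1]) rfl rfl
      rw [this]
  · have hlen : s.2.2.2.1.length = width p := le_antisymm h.length_le (not_lt.1 hw)
    simp only [StreamCoverage.closeSet, hw, decide_false, cond_false]
    obtain ⟨hz, hzmin⟩ := pick_spec (fun e : ℕ × ℕ => p.1 - e.2) s.2.2.2.1 (s.2.1, s.2.2.1)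
    set z := pick (fun e : ℕ × ℕ => p.1 - e.2) (s.2.1, s.2.2.1) s.2.2.2.1 with hzdef
    have hsm : smallest p s = z.1 := rfl
    rw [hsm]
    have hmin : ∀ e ∈ (s.2.1, s.2.2.1) :: s.2.2.2.1, z.2 ≤ e.2 := by
      intro e he
      have h1 := hzmin e he
      have h2 := hW z.1
      have h3 := hW e.1
      rw [← (h.mem_cons hz).2] at h2
      rw [← (h.mem_cons he).2] at h3
      omega
    set l := (s.2.1, s.2.2.1) :: s.2.2.2.1 with hl
    have hmap : (l.filter fun e => !decide (e.1 = z.1)).map Prod.fst = (l.map Prod.fst).erase z.1 := by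
      rw [h.nodup_cons.erase_eq_filter, List.filter_map]
      congr 1

    have hzl : z.1 ∈ l.map Prod.fst := List.mem_map_of_mem hz
    have hlen' : (l.filter fun e => !decide (e.1 = z.1)).length = width p := by
      rw [← List.length_map (f := Prod.fst), hmap, List.length_erase_of_mem hzl]
      simp [hl, hlen]
    have hmem : ∀ e, e ∈ l.filter (fun e => !decide (e.1 = z.1)) ↔ e ∈ l ∧ e.1 ≠ z.1 := by
      intro e
      simp
    have hmem' : ∀ a, a ∈ (l.filter fun e => !decide (e.1 = z.1)).map Prod.fst ↔
        a ∈ l.map Prod.fst ∧ a ≠ z.1 := by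
      intro a
      rw [hmap, h.nodup_cons.mem_erase_iff, and_comm]
    refine ⟨h.seed, by simp [h.pos], rfl, ?_, fun e he => h.mem_cons ((hmem e).1 he).1,
      hlen'.le, ?_, ?_⟩
    · simp only [hmap]
      exact h.nodup_cons.erase _
    · intro a ha hna
      refine ⟨hlen', fun e he => ?_⟩
      obtain ⟨hel, hez⟩ := (hmem e).1 he
      rw [hmem'] at hna
      by_cases haz : a = z.1
      · rw [haz, ← (h.mem_cons hz).2]
        exact hmin e hel
      · have hal : a ∉ l.map Prod.fst := fun hc => hna ⟨hc, haz⟩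
        simp only [hl, List.map_cons, List.mem_cons, not_or, h.pos] at hal
        have hd := (h.dropped a (by omega) hal.2).2
        rcases List.mem_cons.1 hel with rfl | hel'
        · rcases List.mem_cons.1 hz with hz' | hz'
          · exact absurd (congrArg Prod.fst hz').symm hez
          · exact (hd z hz').trans (hmin _ hel)
        · exact hd e hel'
    · intro a x
      simp only
      rw [List.filter_filter]
      by_cases haz : a = z.1
      · have h1 : known W (l.filter fun e => !decide (e.1 = z.1)) (i + 1) [] a = [] := by
          unfold known
          rw [if_neg fun hc => ((hmem' a).1 hc).2 haz]
          simp
        rw [h1, List.filter_eq_nil_iff.2]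
        · simp
        · intro e _
          simp [haz]
          tauto
      · have h1 : known W (l.filter fun e => !decide (e.1 = z.1)) (i + 1) [] a =
            known W s.2.2.2.1 i (W i) a := by
          unfold known
          by_cases h1 : a = i
          · have h2 : a ∈ (l.filter fun e => !decide (e.1 = z.1)).map Prod.fst :=
              (hmem' a).2 ⟨by simp [hl, h.pos, h1], haz⟩
            rw [if_neg (by omega), if_pos h2, if_pos h1, h1]
          · by_cases h2 : a = i + 1
            · have : a ∉ s.2.2.2.1.map Prod.fst := fun hc => by have := h.fst_lt hc; omega
              rw [if_neg h1, if_neg this, if_pos h2]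
            · rw [if_neg h1, if_neg h2]
              refine if_congr ?_ rfl rfl
              rw [hmem']
              simp [hl, h.pos, h1, haz]
        rw [h1, ← h.recs]
        refine List.filter_congr fun e _ => ?_
        by_cases he : e.1 = a
        · simp [he, haz]
        · simp [he]

theorem Inv.addElements (h : Inv γ p W ω i v s) (v' : List ℕ) :
    Inv γ p W ω i (v ++ v') ((v'.map some).foldl (update γ p) s) := by
  induction v' generalizing v s with
  | nil => simpa using h
  | cons u v' ih =>
    have := ih (h.addElement u)
    rwa [List.append_assoc] at this

theorem inv_blocks (γ : ℕ) (p : Params) {W : ℕ → List ℕ} (hW : ∀ j, (W j).length ≤ p.1)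
    (ω i : ℕ) : Inv γ p W ω i [] ((blocks W i).foldl (update γ p) (ω, 0, 0, [], [])) := by
  induction i with
  | zero => exact Inv.start γ p W ω
  | succ i ih =>
    have h1 := (ih.addElements (W i))
    rw [List.nil_append] at h1
    have h2 := h1.closeSet hW
    simp only [blocks, List.range_succ, List.flatMap_append, List.foldl_append] at h2 ⊢
    simpa [List.foldl_append, update] using h2

theorem prefix_blocks {W : ℕ → List ℕ} {m : ℕ} {t : List (Option ℕ)} (ht : t <+: blocks W m) :
    t = blocks W m ∨ ∃ i < m, ∃ v, v <+: W i ∧ t = blocks W i ++ v.map some := by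
  induction m with
  | zero => exact Or.inl (List.prefix_nil.1 ht)
  | succ m ih =>
    have hb : blocks W (m + 1) = blocks W m ++ ((W m).map some ++ [none]) := by
      simp [blocks, List.range_succ]
    rw [hb] at ht ⊢
    rcases List.prefix_or_prefix_of_prefix ht (List.prefix_append _ _) with h | h
    · rcases ih h with rfl | ⟨i, hi, v, hv, rfl⟩
      · exact Or.inr ⟨m, Nat.lt_succ_self m, [], List.nil_prefix, by simp⟩
      · exact Or.inr ⟨i, hi.trans (Nat.lt_succ_self m), v, hv, rfl⟩
    · obtain ⟨t', rfl⟩ := h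
      rw [List.prefix_append_right_inj, List.prefix_concat_iff] at ht
      rcases ht with rfl | ht
      · exact Or.inl rfl
      · refine Or.inr ⟨m, Nat.lt_succ_self m, ?_⟩
        obtain ⟨v, hv, rfl⟩ := List.prefix_map_iff.1 ht
        exact ⟨v, hv, rfl⟩

/-- Every prefix of the stream leads to a state as described by the invariant. -/
theorem exists_inv (γ : ℕ) (p : Params) {W : ℕ → List ℕ} (hW : ∀ j, (W j).length ≤ p.1)
    (ω : ℕ) {m : ℕ} {t : List (Option ℕ)} (ht : t <+: blocks W m) :
    ∃ i ≤ m, ∃ v, v <+: W i ∧ Inv γ p W ω i v (t.foldl (update γ p) (ω, 0, 0, [], [])) := by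
  rcases prefix_blocks ht with rfl | ⟨i, hi, v, hv, rfl⟩
  · exact ⟨m, le_rfl, [], List.nil_prefix, inv_blocks γ p hW ω m⟩
  · refine ⟨i, hi.le, v, hv, ?_⟩
    rw [List.foldl_append]
    exact (inv_blocks γ p hW ω i).addElements v

theorem Inv.mem_recs (h : Inv γ p W ω i v s) {a x u : ℕ} :
    (a, x, u) ∈ s.2.2.2.2 ↔ x < levels p * reps γ p ∧
      u ∈ ((known W s.2.2.2.1 i v a).filter fun u => sampled γ p ω x u).take (cap p) := by
  have h1 : (a, x, u) ∈ s.2.2.2.2 ↔ (a, x, u) ∈ s.2.2.2.2.filter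
      (fun e => decide (e.1 = a) && decide (e.2.1 = x)) := by simp
  rw [h1, h.recs]
  split_ifs with hx <;> simp [hx, -List.map_take]

theorem Inv.known_subset (_ : Inv γ p W ω i v s) (hv : v <+: W i) {a u : ℕ}
    (hu : u ∈ known W s.2.2.2.1 i v a) : u ∈ W a ∧ (a = i ∨ a ∈ s.2.2.2.1.map Prod.fst) := by
  unfold known at hu
  split_ifs at hu with h1 h2
  · exact ⟨h1 ▸ hv.subset hu, Or.inl h1⟩
  · exact ⟨hu, Or.inr h2⟩
  · simp at hu

theorem Inv.mem_recs_imp (h : Inv γ p W ω i v s) (hv : v <+: W i) {a x u : ℕ}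
    (hr : (a, x, u) ∈ s.2.2.2.2) : x < levels p * reps γ p ∧ u ∈ W a ∧
      (a = i ∨ a ∈ s.2.2.2.1.map Prod.fst) := by
  obtain ⟨hx, hu⟩ := h.mem_recs.1 hr
  exact ⟨hx, h.known_subset hv (List.mem_of_mem_filter (List.mem_of_mem_take hu))⟩

theorem Inv.recs_length_le (h : Inv γ p W ω i v s) (hv : v <+: W i) :
    s.2.2.2.2.length ≤ (width p + 1) * (levels p * reps γ p) * cap p := by
  set K := insert i (s.2.2.2.1.map Prod.fst).toFinset ×ˢ Finset.range (levels p * reps γ p)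
  have hK : K.card ≤ (width p + 1) * (levels p * reps γ p) := by
    rw [Finset.card_product, Finset.card_range]
    gcongr
    refine (Finset.card_insert_le _ _).trans ?_
    gcongr
    refine (List.toFinset_card_le _).trans ?_
    rw [List.length_map]
    exact h.length_le
  refine (length_le_of_filter_le (fun e => (e.1, e.2.1)) K (cap p) _ ?_ ?_).trans (by gcongr)
  · rintro ⟨a, x, u⟩ he
    obtain ⟨h1, -, h2⟩ := h.mem_recs_imp hv he
    rw [Finset.mem_product, Finset.mem_insert, List.mem_toFinset]
    exact ⟨h2, Finset.mem_range.2 h1⟩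
  · rintro ⟨a, x⟩ hx
    have h1 := h.recs a x
    rw [if_pos (by simpa using (Finset.mem_product.1 hx).2)] at h1
    have h2 : (s.2.2.2.2.filter fun e => decide ((e.1, e.2.1) = (a, x))) =
        s.2.2.2.2.filter (fun e => decide (e.1 = a) && decide (e.2.1 = x)) :=
      List.filter_congr fun e _ => by simp
    rw [h2, h1, List.length_map, List.length_take]
    exact min_le_left _ _

theorem Inv.bounded (h : Inv γ p W ω i v s) (hv : v <+: W i) (hi : i ≤ p.2.1)
    (hW : ∀ j, (W j).length ≤ p.1) (hWn : ∀ j, ∀ u ∈ W j, u < p.1) :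
    Bounded (p.2.1 + p.1 + levels p * reps γ p + 2) s := by
  constructor
  · intro e he
    obtain ⟨h1, h2⟩ := h.mem e he
    have := hW e.1
    omega
  · rintro ⟨a, x, u⟩ he
    obtain ⟨h1, h2, h3⟩ := h.mem_recs_imp hv he
    have h4 := hWn a u h2
    have h5 : a ≤ i := h3.elim le_of_eq fun h' => (h.fst_lt h').le
    simp only
    omega

/-- As long as the memory is used, it holds the state of the algorithm. -/
theorem memory_eq {m : ℕ} (hr : p.2.2.2.1 ≠ 0) (hm : m = p.2.1) (hW : ∀ j, (W j).length ≤ p.1)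
    (hWn : ∀ j, ∀ u ∈ W j, u < p.1) (ω : ℕ) {t : List (Option ℕ)} (ht : t <+: blocks W m) :
    (coverageAlgorithm γ).memory p ω t =
      pack (base γ p) (t.foldl (update γ p) (ω, 0, 0, [], [])) := by
  induction t using List.reverseRecOn with
  | nil => simp [OnePassAlgorithm.memory, coverageAlgorithm, startMemory, hr]
  | append_singleton t x ih =>
    have ht' : t <+: blocks W m := (List.prefix_append _ _).trans ht
    obtain ⟨i, hi, v, hv, hinv⟩ := exists_inv γ p hW ω ht'
    have h1 := ih ht'
    rw [OnePassAlgorithm.memory] at h1 ⊢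
    rw [List.foldl_append, List.foldl_append, h1]
    simp only [List.foldl_cons, List.foldl_nil]
    change stepMemory γ p _ _ = _
    simp only [stepMemory, hr, decide_false, cond_false]
    rw [base, unpack_pack (by omega) (hinv.bounded hv (hm ▸ hi) hW hWn)]

end Run

/-! ### The solution computed from the final state -/

section Answer

/-- The positions of the elements of the set `j`, in their order of arrival. -/
def tokens {n m : ℕ} (w : Fin m → List (Fin n)) (j : ℕ) : List ℕ :=
  if h : j < m then (w ⟨j, h⟩).map Fin.val else []

variable {n m : ℕ} {w : Fin m → List (Fin n)} {S : Fin m → Finset (Fin n)}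

theorem stream_eq_blocks (w : Fin m → List (Fin n)) : stream w = blocks (tokens w) m := by
  unfold stream blocks
  rw [← List.map_coe_finRange_eq_range, List.flatMap_map]
  congr 1
  funext i
  simp [tokens]

theorem mem_tokens {j : ℕ} {u : ℕ} (h : u ∈ tokens w j) : u < n := by
  unfold tokens at h
  split_ifs at h
  · obtain ⟨v, -, rfl⟩ := List.mem_map.1 h
    exact v.2
  · simp at h

theorem mem_tokens_iff (hw : Lists w S) (i : Fin m) (u : Fin n) :
    u.val ∈ tokens w i ↔ u ∈ S i := by
  simp only [tokens, i.2, dif_pos, Fin.eta, List.mem_map]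
  rw [← (hw i).2, List.mem_toFinset]
  constructor
  · rintro ⟨v, hv, h⟩
    rwa [← Fin.ext h]
  · intro h
    exact ⟨u, h, rfl⟩

theorem length_tokens (hw : Lists w S) (i : Fin m) : (tokens w i).length = (S i).card := by
  simp only [tokens, i.2, dif_pos, Fin.eta, List.length_map]
  rw [← (hw i).2, List.toFinset_card_of_nodup (hw i).1]

theorem length_tokens_le (hw : Lists w S) (j : ℕ) : (tokens w j).length ≤ n := by
  by_cases h : j < m
  · have := length_tokens hw ⟨j, h⟩
    simp only at this
    rw [this]
    exact (Finset.card_le_univ _).trans (by simp)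
  · simp [tokens, h]

theorem length_filter_tokens (hw : Lists w S) (i : Fin m) (P : ℕ → Bool) :
    ((tokens w i).filter P).length = ((S i).filter fun u => P u.val = true).card := by
  simp only [tokens, i.2, dif_pos, Fin.eta, List.filter_map, List.length_map]
  rw [← (hw i).2, ← List.toFinset_filter, List.toFinset_card_of_nodup ((hw i).1.filter _)]
  rfl

theorem length_filter_range (P : ℕ → Bool) (n : ℕ) :
    ((List.range n).filter P).length = (Finset.univ.filter fun u : Fin n => P u.val = true).card := by
  have h : (Finset.univ.filter fun u : Fin n => P u.val = true).map Fin.valEmbedding =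
      (Finset.range n).filter fun u => P u = true := by
    ext u
    simp only [Finset.mem_map, Finset.mem_filter, Finset.mem_univ, true_and, Fin.valEmbedding_apply,
      Finset.mem_range]
    constructor
    · rintro ⟨v, hv, rfl⟩
      exact ⟨v.2, hv⟩
    · rintro ⟨h, hu⟩
      exact ⟨⟨u, h⟩, hu, rfl⟩
  rw [← Finset.card_map Fin.valEmbedding, h, ← List.toFinset_range, ← List.toFinset_filter,
    List.toFinset_card_of_nodup (List.nodup_range.filter _)]

theorem card_selection_le (D : List ℕ) : (selection m D).card ≤ D.length := by
  rw [← Finset.card_map Fin.valEmbedding]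
  refine (Finset.card_le_card ?_).trans (List.toFinset_card_le D)
  intro x hx
  obtain ⟨i, hi, rfl⟩ := Finset.mem_map.1 hx
  exact List.mem_toFinset.2 (Finset.mem_filter.1 hi).2

theorem length_filter_eq_card {D : List ℕ} (hD : D.Nodup) (hm : ∀ i ∈ D, i < m) (P : ℕ → Bool) :
    (D.filter P).length = ((selection m D).filter fun i => P i.val = true).card := by
  rw [← List.toFinset_card_of_nodup (hD.filter _), ← Finset.card_map Fin.valEmbedding]
  congr 1
  ext x
  simp only [List.mem_toFinset, List.mem_filter, Finset.mem_map, Finset.mem_filter, selection,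
    Finset.mem_univ, true_and, Fin.valEmbedding_apply]
  constructor
  · rintro ⟨h, hx⟩
    exact ⟨⟨x, hm x h⟩, ⟨h, hx⟩, rfl⟩
  · rintro ⟨i, h, rfl⟩
    exact h

variable {γ : ℕ} {p : Params} {ω : ℕ} {s : State} {g : ℕ → Bool}

/-- If no sample of a set in `D` was truncated, the value of `D` in the sample is known. -/
theorem sampleVal_eq (h0 : g 0 = false) (hn : p.1 = n) (hw : Lists w S)
    (h : Inv γ p (tokens w) ω m [] s) {j l : ℕ} (hj : j < levels p) (hl : l < reps γ p)
    {D : List ℕ} (hD : D.Sublist (s.2.2.2.1.map fun e => e.1))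
    (hcap : ∀ i ∈ selection m D, sampleCount (prm n) (thr p j)
      (digit (prm n * prm n) ω l) (S i) ≤ cap p) :
    sampleVal g n s.2.2.2.2 (j * reps γ p + l) D =
      sampleCount (prm n) (thr p j) (digit (prm n * prm n) ω l)
        (valueSet g S (selection m D)) := by
  have hDn : D.Nodup := hD.nodup h.nodup
  have hDm : ∀ i ∈ D, i < m := fun i hi => h.fst_lt (hD.subset hi)
  have hL : 0 < reps γ p := by omega
  have hx : j * reps γ p + l < levels p * reps γ p := by
    calc j * reps γ p + l < j * reps γ p + reps γ p := by omega
      _ = (j + 1) * reps γ p := by ring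
      _ ≤ _ := Nat.mul_le_mul_right _ hj
  have hs : ∀ u, sampled γ p ω (j * reps γ p + l) u =
      decide (hash (prm n) (digit (prm n * prm n) ω l) u < thr p j) := by
    intro u
    have e1 : (j * reps γ p + l) % reps γ p = l := by
      rw [Nat.mul_add_mod_self_right, Nat.mod_eq_of_lt hl]
    have e2 : (j * reps γ p + l) / reps γ p = j := by
      rw [mul_comm, Nat.mul_add_div hL, Nat.div_eq_of_lt hl, add_zero]
    rw [sampled, e1, e2, hn]
  have hrec : ∀ i ∈ selection m D, ∀ u : Fin n,
      memList (i.val, j * reps γ p + l, u.val) s.2.2.2.2 = true ↔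
        u ∈ S i ∧ hash (prm n) (digit (prm n * prm n) ω l) u < thr p j := by
    intro i hi u
    have hiD : i.val ∈ D := (Finset.mem_filter.1 hi).2
    have hk : known (tokens w) s.2.2.2.1 m [] i = tokens w i := by
      unfold known
      rw [if_neg i.2.ne, if_pos (hD.subset hiD)]
    rw [memList_eq_true, h.mem_recs, hk, List.take_of_length_le]
    · rw [List.mem_filter, hs, decide_eq_true_iff, mem_tokens_iff hw]
      exact and_iff_right hx
    · rw [length_filter_tokens hw]
      refine le_trans (le_of_eq ?_) (hcap i hi)
      simp only [hs, decide_eq_true_iff]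
      rfl
  rw [sampleVal, length_filter_range, sampleCount, valueSet, Finset.filter_filter]
  congr 1
  refine Finset.filter_congr fun u _ => ?_
  rw [length_filter_eq_card hDn hDm, Finset.filter_congr fun i hi => hrec i hi u]
  by_cases hu : hash (prm n) (digit (prm n * prm n) ω l) u < thr p j
  · simp [hu, hits]
  · simp [hu, h0]

theorem median_bounds {N L : ℕ} {X : ℕ → ℕ} (hX : ∀ l, X l ≤ N) {bad : ℕ → Prop}
    [DecidablePred bad] (hbad : 2 * ((Finset.range L).filter bad).card < L) :
    (∃ l < L, ¬bad l ∧ X l ≤ ((List.range N).filter fun v => decide (L ≤ 2 *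
      ((List.range L).filter fun l => decide (v < X l)).length)).length) ∧
    ∃ l < L, ¬bad l ∧ ((List.range N).filter fun v => decide (L ≤ 2 *
      ((List.range L).filter fun l => decide (v < X l)).length)).length ≤ X l := by
  have hlen : ∀ v, ((List.range L).filter fun l => decide (v < X l)).length =
      ((Finset.range L).filter fun l => v < X l).card := by
    intro v
    rw [← List.toFinset_card_of_nodup (List.nodup_range.filter _), List.toFinset_filter,
      List.toFinset_range]
    simp
  have hlen' : ((List.range N).filter fun v => decide (L ≤ 2 *
      ((List.range L).filter fun l => decide (v < X l)).length)).length =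
      ((Finset.range N).filter fun v => L ≤ 2 * ((Finset.range L).filter
        fun l => v < X l).card).card := by
    simp_rw [hlen]
    rw [← List.toFinset_card_of_nodup (List.nodup_range.filter _), List.toFinset_filter,
      List.toFinset_range]
    simp
  rw [hlen']
  have hsum := Finset.card_filter_add_card_filter_not (s := Finset.range L) bad
  rw [Finset.card_range] at hsum
  have hne : ((Finset.range L).filter fun l => ¬bad l).Nonempty := Finset.card_pos.1 (by omega)
  obtain ⟨l0, hl0, hmin⟩ := Finset.exists_min_image _ X hne
  obtain ⟨l1, hl1, hmax⟩ := Finset.exists_max_image _ X hne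
  rw [Finset.mem_filter, Finset.mem_range] at hl0 hl1
  refine ⟨⟨l0, hl0.1, hl0.2, ?_⟩, ⟨l1, hl1.1, hl1.2, ?_⟩⟩
  · rw [← Finset.card_range (X l0)]
    refine Finset.card_le_card fun v hv => ?_
    rw [Finset.mem_range] at hv
    rw [Finset.mem_filter, Finset.mem_range]
    refine ⟨hv.trans_le (hX l0), ?_⟩
    have : ((Finset.range L).filter fun l => ¬bad l).card ≤
        ((Finset.range L).filter fun l => v < X l).card :=
      Finset.card_le_card fun l hl => Finset.mem_filter.2
        ⟨(Finset.mem_filter.1 hl).1, hv.trans_le (hmin l hl)⟩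
    omega
  · rw [← Finset.card_range (X l1)]
    refine Finset.card_le_card fun v hv => ?_
    rw [Finset.mem_filter] at hv
    rw [Finset.mem_range]
    by_contra hcon
    have : ((Finset.range L).filter fun l => v < X l).card ≤ ((Finset.range L).filter bad).card :=
      Finset.card_le_card fun l hl => by
        rw [Finset.mem_filter] at hl ⊢
        refine ⟨hl.1, ?_⟩
        by_contra hb
        have := hmax l (Finset.mem_filter.2 ⟨hl.1, hb⟩)
        omega
    omega

/-- The size of the largest set. -/
def maxSize (S : Fin m → Finset (Fin n)) : ℕ := Finset.univ.sup fun i => (S i).card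

theorem card_le_maxSize (S : Fin m → Finset (Fin n)) (i : Fin m) : (S i).card ≤ maxSize S :=
  Finset.le_sup (f := fun i => (S i).card) (Finset.mem_univ i)

theorem maxSize_le (S : Fin m → Finset (Fin n)) : maxSize S ≤ n :=
  Finset.sup_le fun _ _ => (Finset.card_le_univ _).trans (by simp)

/-- The sets kept by the algorithm. -/
def kept (m : ℕ) (s : State) : Finset (Fin m) := selection m (s.2.2.2.1.map fun e => e.1)

theorem Inv.mem_kept (h : Inv γ p (tokens w) ω m [] s) (hw : Lists w S) {i : Fin m}
    (hi : i ∈ kept m s) : ∃ e ∈ s.2.2.2.1, e.1 = i ∧ e.2 = (S i).card := by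
  obtain ⟨e, he, h1⟩ := List.mem_map.1 (Finset.mem_filter.1 hi).2
  exact ⟨e, he, h1, by rw [(h.mem e he).2, h1, length_tokens hw]⟩

theorem Inv.notMem_kept (h : Inv γ p (tokens w) ω m [] s) (hw : Lists w S) {i : Fin m}
    (hi : i ∉ kept m s) :
    s.2.2.2.1.length = width p ∧ ∀ e ∈ s.2.2.2.1, (S i).card ≤ e.2 := by
  have := h.dropped i i.2 fun hc => hi (Finset.mem_filter.2 ⟨Finset.mem_univ _, hc⟩)
  rwa [length_tokens hw] at this

theorem Inv.card_kept (h : Inv γ p (tokens w) ω m [] s) :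
    (kept m s).card = s.2.2.2.1.length := by
  have h1 := length_filter_eq_card h.nodup (fun i hi => h.fst_lt hi) (fun _ => true)
  simp only [List.filter_true, List.length_map, Finset.filter_true] at h1
  exact h1.symm

theorem Inv.level_eq (h : Inv γ p (tokens w) ω m [] s) (hw : Lists w S) (hp : 0 < width p) :
    level s.2.2.2.1 = Nat.log 2 (maxSize S) := by
  unfold level
  congr 1
  obtain ⟨h1, h2⟩ := pick_spec Prod.snd s.2.2.2.1 ((0, 0) : ℕ × ℕ)
  apply le_antisymm
  · rcases List.mem_cons.1 h1 with h1 | h1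
    · simp [h1]
    · obtain ⟨h3, h4⟩ := h.mem _ h1
      rw [h4]
      have := length_tokens hw ⟨_, h3⟩
      simp only at this
      rw [this]
      exact card_le_maxSize S _
  · refine Finset.sup_le fun i _ => ?_
    by_cases hi : i ∈ kept m s
    · obtain ⟨e, he, -, h3⟩ := h.mem_kept hw hi
      rw [← h3]
      exact h2 e (List.mem_cons_of_mem _ he)
    · obtain ⟨h3, h4⟩ := h.notMem_kept hw hi
      obtain ⟨e, he⟩ := List.exists_mem_of_length_pos (h3 ▸ hp)
      exact (h4 e he).trans (h2 e (List.mem_cons_of_mem _ he))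

/-- For most of the samples, the sampled value of `D` is close to its expectation. -/
def Reliable (g : ℕ → Bool) (γ : ℕ) (p : Params) (S : Fin m → Finset (Fin n)) (ω : ℕ)
    (D : Finset (Fin m)) : Prop :=
  2 * ((Finset.range (reps γ p)).filter fun l => digit (prm n * prm n) ω l ∈
    badSeeds g S (prm n) (thr p (Nat.log 2 (maxSize S))) (cap p) (prec p)
      (optimum p.2.2.1 (value g S)) D).card < reps γ p

theorem digit_lt {Q : ℕ} (hQ : 0 < Q) (ω l : ℕ) : digit Q ω l < Q := Nat.mod_lt _ hQ

theorem Inv.score_bounds (h : Inv γ p (tokens w) ω m [] s) (h0 : g 0 = false) (hn : p.1 = n)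
    (hw : Lists w S) (hp : 0 < width p) {D : List ℕ}
    (hD : D.Sublist (s.2.2.2.1.map fun e => e.1)) (hR : Reliable g γ p S ω (selection m D)) :
    (prec p * (prm n * score g γ p s.2.2.2.2 (level s.2.2.2.1) D : ℤ) ≤
      thr p (level s.2.2.2.1) *
        (prec p * value g S (selection m D) + optimum p.2.2.1 (value g S))) ∧
    (thr p (level s.2.2.2.1) *
        (prec p * value g S (selection m D) - optimum p.2.2.1 (value g S)) ≤
      prec p * (prm n * score g γ p s.2.2.2.2 (level s.2.2.2.1) D : ℤ)) := by
  have hlev := h.level_eq hw hp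
  have hj : level s.2.2.2.1 < levels p := by
    rw [hlev, levels, hn, Nat.lt_succ_iff]
    exact Nat.log_mono_right (maxSize_le S)
  have hX : ∀ l, sampleVal g p.1 s.2.2.2.2 (level s.2.2.2.1 * reps γ p + l) D ≤ p.1 := fun l =>
    (List.length_filter_le _ _).trans (by simp)
  obtain ⟨⟨l0, hl0, hg0, hs0⟩, l1, hl1, hg1, hs1⟩ := median_bounds hX hR
  change _ ≤ score g γ p s.2.2.2.2 (level s.2.2.2.1) D at hs0
  change score g γ p s.2.2.2.2 (level s.2.2.2.1) D ≤ _ at hs1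
  have key : ∀ l < reps γ p, digit (prm n * prm n) ω l ∉ badSeeds g S (prm n)
      (thr p (Nat.log 2 (maxSize S))) (cap p) (prec p) (optimum p.2.2.1 (value g S))
      (selection m D) →
      (prec p : ℤ) * |(prm n : ℤ) * sampleVal g p.1 s.2.2.2.2 (level s.2.2.2.1 * reps γ p + l) D -
        thr p (level s.2.2.2.1) * value g S (selection m D)| ≤
      thr p (level s.2.2.2.1) * optimum p.2.2.1 (value g S) := by
    intro l hl hbad
    rw [badSeeds, Finset.mem_filter, not_and, not_or] at hbad
    have hpos := prm_pos n
    obtain ⟨hb1, hb2⟩ := hbad (Finset.mem_range.2 (digit_lt (by positivity) _ _))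
    push Not at hb1
    rw [← hlev] at hb1 hb2
    rw [hn, sampleVal_eq h0 hn hw h hj hl hD hb1]
    exact not_lt.1 hb2
  have k0 := key l0 hl0 hg0
  have k1 := key l1 hl1 hg1
  have hE : (0 : ℤ) ≤ prec p := by positivity
  have hq : (0 : ℤ) ≤ prm n := by positivity
  have hs0' : ((sampleVal g p.1 s.2.2.2.2 (level s.2.2.2.1 * reps γ p + l0) D : ℕ) : ℤ) ≤
    score g γ p s.2.2.2.2 (level s.2.2.2.1) D := by exact_mod_cast hs0
  have hs1' : (score g γ p s.2.2.2.2 (level s.2.2.2.1) D : ℤ) ≤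
    sampleVal g p.1 s.2.2.2.2 (level s.2.2.2.1 * reps γ p + l1) D := by exact_mod_cast hs1
  have m0 := mul_le_mul_of_nonneg_left (neg_abs_le ((prm n : ℤ) * sampleVal g p.1 s.2.2.2.2
    (level s.2.2.2.1 * reps γ p + l0) D - thr p (level s.2.2.2.1) * value g S (selection m D))) hE
  have m1 := mul_le_mul_of_nonneg_left (le_abs_self ((prm n : ℤ) * sampleVal g p.1 s.2.2.2.2
    (level s.2.2.2.1 * reps γ p + l1) D - thr p (level s.2.2.2.1) * value g S (selection m D))) hE
  have n0 := mul_le_mul_of_nonneg_left (mul_le_mul_of_nonneg_left hs0' hq) hE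
  have n1 := mul_le_mul_of_nonneg_left (mul_le_mul_of_nonneg_left hs1' hq) hE
  constructor
  · linarith
  · linarith

theorem prec_pos (p : Params) : 0 < prec p := by unfold prec; positivity

theorem thr_pos (p : Params) (j : ℕ) : 0 < thr p j := lt_min (prm_pos _) (Nat.succ_pos _)

/-- If all small collections are reliable, the solution computed is almost optimal. -/
theorem Inv.solve_spec (h : Inv γ p (tokens w) ω m [] s) (h0 : g 0 = false) (h1 : g 1 = true)
    (hn : p.1 = n) (hw : Lists w S) (hk : 0 < p.2.2.1) (hr : 0 < p.2.2.2.1)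
    (hS : ∀ u, multiplicity S u ≤ p.2.2.2.1) :
    ((∀ i ∈ solve g γ p s, i < m) ∧ (selection m (solve g γ p s)).card ≤ p.2.2.1) ∧
    ((∀ D : Finset (Fin m), D.card ≤ p.2.2.1 → Reliable g γ p S ω D) →
      (prec p * optimum p.2.2.1 (value g S) : ℤ) ≤
        prec p * value g S (selection m (solve g γ p s)) + 3 * optimum p.2.2.1 (value g S)) := by
  have hp : 0 < width p := by unfold width; omega
  obtain ⟨hmem, hmax⟩ := pick_spec (score g γ p s.2.2.2.2 (level s.2.2.2.1))
    ((subs (s.2.2.2.1.map fun e => e.1)).filter fun D => decide (D.length ≤ p.2.2.1)) []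
  change solve g γ p s ∈ _ at hmem
  have hmem' : (solve g γ p s).Sublist (s.2.2.2.1.map fun e => e.1) ∧
      (solve g γ p s).length ≤ p.2.2.1 := by
    rcases List.mem_cons.1 hmem with hm | hm
    · simp [hm]
    · simpa [mem_subs] using hm
  have hcard := (card_selection_le (m := m) (solve g γ p s)).trans hmem'.2
  refine ⟨⟨fun i hi => h.fst_lt (hmem'.1.subset hi), hcard⟩, fun hR => ?_⟩
  obtain ⟨D, hDK, hDk, hD⟩ := exists_value_ge (S := S) h0 h1 hr hk (prec_pos p) hS (K := kept m s) (by
    intro i hi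
    obtain ⟨e1, e2⟩ := h.notMem_kept hw hi
    refine ⟨by rw [h.card_kept, e1]; rfl, fun j hj => ?_⟩
    obtain ⟨e, he, -, e4⟩ := h.mem_kept hw hj
    exact e4 ▸ e2 e he)
  set l := (s.2.2.2.1.map fun e => e.1).filter (fun a => decide (∃ i ∈ D, i.val = a)) with hl
  have hlsub : l.Sublist (s.2.2.2.1.map fun e => e.1) := List.filter_sublist
  have hsel : selection m l = D := by
    ext i
    simp only [selection, hl, Finset.mem_filter, Finset.mem_univ, true_and, List.mem_filter,
      decide_eq_true_eq]
    constructor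
    · rintro ⟨-, j, hj, hij⟩
      rwa [← Fin.ext hij]
    · intro hi
      exact ⟨(Finset.mem_filter.1 (hDK hi)).2, i, hi, rfl⟩
  have hlen : l.length = D.card := by
    have := length_filter_eq_card (m := m) (hlsub.nodup h.nodup)
      (fun i hi => h.fst_lt (hlsub.subset hi)) (fun _ => true)
    simpa [hsel] using this
  have hle := hmax l (List.mem_cons_of_mem _ (List.mem_filter.2 ⟨mem_subs.2 hlsub, by
    rw [hlen]; simpa using hDk⟩))
  change score g γ p s.2.2.2.2 (level s.2.2.2.1) l ≤
    score g γ p s.2.2.2.2 (level s.2.2.2.1) (solve g γ p s) at hle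
  have b1 := (h.score_bounds h0 hn hw hp hmem'.1 (hR _ hcard)).1
  have b2 := (h.score_bounds h0 hn hw hp hlsub (by rw [hsel]; exact hR D hDk)).2
  rw [hsel] at b2
  have hE : (0 : ℤ) ≤ prec p := by positivity
  have hq : (0 : ℤ) ≤ prm n := by positivity
  have hle' : (score g γ p s.2.2.2.2 (level s.2.2.2.1) l : ℤ) ≤
    score g γ p s.2.2.2.2 (level s.2.2.2.1) (solve g γ p s) := by exact_mod_cast hle
  have n0 := mul_le_mul_of_nonneg_left (mul_le_mul_of_nonneg_left hle' hq) hE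
  have hD' : (prec p * optimum p.2.2.1 (value g S) : ℤ) ≤
    prec p * value g S D + optimum p.2.2.1 (value g S) := by exact_mod_cast hD
  have ht : (0 : ℤ) < thr p (level s.2.2.2.1) := by exact_mod_cast thr_pos _ _
  have := le_of_mul_le_mul_left (b2.trans (n0.trans b1)) ht
  linarith

end Answer

/-! ### Probability of success -/

section Success

variable {n m : ℕ} {S : Fin m → Finset (Fin n)} {g : ℕ → Bool}

theorem prm_spec (n : ℕ) : (prm n).Prime ∧ n ≤ prm n ∧ prm n ≤ 2 * (n + 1) := by
  obtain ⟨q, hq, h1, h2⟩ := Nat.exists_prime_lt_and_le_two_mul (n + 1) (by omega)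
  exact ⟨Nat.findGreatest_spec h2 hq, by have := Nat.le_findGreatest h2 hq; unfold prm; omega,
    Nat.findGreatest_le _⟩

theorem optimum_eq_zero (h0 : g 0 = false) (hS : maxSize S = 0) (k : ℕ) :
    optimum k (value g S) = 0 := by
  obtain ⟨C, -, hC⟩ := exists_optimum k (value g S)
  rw [← hC, value, Finset.card_eq_zero, ← Finset.subset_empty]
  refine (valueSet_subset_covered h0 C).trans fun u hu => ?_
  obtain ⟨i, -, hi⟩ := mem_covered.1 hu
  have h1 : (S i).card = 0 := Nat.le_zero.1 (hS ▸ card_le_maxSize S i)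
  rw [Finset.card_eq_zero] at h1
  rwa [h1] at hi

/-- The random numbers for which some small collection is not reliable. -/
noncomputable def unreliable (g : ℕ → Bool) (γ : ℕ) (p : Params) (S : Fin m → Finset (Fin n)) : Finset ℕ :=
  open Classical in
  (Finset.range ((prm n * prm n) ^ reps γ p)).filter fun ω =>
    ∃ D : Finset (Fin m), D.card ≤ p.2.2.1 ∧ ¬Reliable g γ p S ω D

theorem card_unreliable_le (h0 : g 0 = false) (h1 : g 1 = true) (γ : ℕ) {p : Params}
    (hn : p.1 = n) (hk : 0 < p.2.2.1) (hS : 0 < maxSize S) :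
    (unreliable g γ p S).card * 2 ^ reps γ p ≤
      (m + 1) ^ p.2.2.1 * (prm n * prm n) ^ reps γ p := by
  classical
  set k := p.2.2.1 with hkdef
  set q := prm n
  set L := reps γ p
  obtain ⟨hq, hnq, -⟩ := prm_spec n
  have hbad : ∀ D : Finset (Fin m), D.card ≤ k →
      ((Finset.range ((q * q) ^ L)).filter fun ω => ¬Reliable g γ p S ω D).card * 2 ^ L ≤
        (q * q) ^ L := by
    intro D hD
    have hb := card_badSeeds_le (g := g) (S := S) (M := maxSize S) (k := k) (E := prec p)
      (O := optimum k (value g S)) (j := Nat.log 2 (maxSize S))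
      (t := thr p (Nat.log 2 (maxSize S))) hq hnq hk hD (card_le_maxSize S) (maxSize_le S)
      (Nat.lt_pow_succ_log_self (by norm_num) _) (Nat.pow_log_le_self 2 hS.ne')
      (Finset.sup_le fun i _ => card_le_optimum h0 h1 hk i) (le_optimum _ hD) (by
        rw [thr, hn])
    have hc := card_majority_le (Q := q * q) (L := L) (Finset.filter_subset _ _) hb
    convert hc using 4 with ω
    rw [Reliable, not_lt]
    rfl
  have hsub : unreliable g γ p S ⊆ (Finset.univ.filter fun D : Finset (Fin m) =>
      D.card ≤ k).biUnion fun D =>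
        (Finset.range ((q * q) ^ L)).filter fun ω => ¬Reliable g γ p S ω D := by
    intro ω hω
    obtain ⟨hω, D, hD, hR⟩ := Finset.mem_filter.1 hω
    exact Finset.mem_biUnion.2 ⟨D, by simpa using hD, Finset.mem_filter.2 ⟨hω, hR⟩⟩
  calc (unreliable g γ p S).card * 2 ^ L
      ≤ (∑ D ∈ Finset.univ.filter fun D : Finset (Fin m) => D.card ≤ k,
        ((Finset.range ((q * q) ^ L)).filter fun ω => ¬Reliable g γ p S ω D).card) * 2 ^ L := by
        gcongr
        exact (Finset.card_le_card hsub).trans Finset.card_biUnion_le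
    _ = ∑ D ∈ Finset.univ.filter fun D : Finset (Fin m) => D.card ≤ k,
        ((Finset.range ((q * q) ^ L)).filter fun ω => ¬Reliable g γ p S ω D).card * 2 ^ L :=
        Finset.sum_mul _ _ _
    _ ≤ (Finset.univ.filter fun D : Finset (Fin m) => D.card ≤ k).card • (q * q) ^ L :=
        Finset.sum_le_card_nsmul _ _ _ fun D hD => hbad D (Finset.mem_filter.1 hD).2
    _ ≤ (m + 1) ^ k * (q * q) ^ L := by
        rw [smul_eq_mul]
        gcongr
        exact card_small_subsets_le m k

theorem two_pow_reps_ge (γ : ℕ) {p : Params} (hm : p.2.1 = m) :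
    2 * (m + 1) ^ (p.2.2.1 + γ) ≤ 2 ^ reps γ p := by
  rw [reps, pow_add 2 1, pow_one, hm, mul_comm (p.2.2.1 + γ), pow_mul]
  gcongr
  exact (Nat.lt_pow_succ_log_self (by norm_num) _).le

theorem card_unreliable_union_le (γ : ℕ) {p : Params} {g' : ℕ → Bool} (h0 : g 0 = false)
    (h1 : g 1 = true) (h0' : g' 0 = false) (h1' : g' 1 = true)
    (hn : p.1 = n) (hm : p.2.1 = m) (hk : 0 < p.2.2.1) (hS : 0 < maxSize S) :
    (unreliable g γ p S ∪ unreliable g' γ p S).card * (m + 1) ^ γ ≤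
      (prm n * prm n) ^ reps γ p := by
  have e1 := card_unreliable_le (S := S) h0 h1 γ hn hk hS
  have e2 := card_unreliable_le (S := S) h0' h1' γ hn hk hS
  have e3 := two_pow_reps_ge γ hm
  have e4 := Finset.card_union_le (unreliable g γ p S) (unreliable g' γ p S)
  set F := (unreliable g γ p S ∪ unreliable g' γ p S).card
  set N := (prm n * prm n) ^ reps γ p
  refine Nat.le_of_mul_le_mul_left ?_ (show 0 < 2 * (m + 1) ^ p.2.2.1 by positivity)
  calc 2 * (m + 1) ^ p.2.2.1 * (F * (m + 1) ^ γ)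
      = F * (2 * (m + 1) ^ (p.2.2.1 + γ)) := by rw [pow_add]; ring
    _ ≤ ((unreliable g γ p S).card + (unreliable g' γ p S).card) * 2 ^ reps γ p := by gcongr
    _ ≤ (m + 1) ^ p.2.2.1 * N + (m + 1) ^ p.2.2.1 * N := by rw [add_mul]; gcongr
    _ = _ := by ring

theorem isApprox_of_le {a b : ℕ} {ε : ℝ} (ha : 0 < a) (hab : a ≤ b) (hε : ε = a / b) {O T : ℕ}
    (h : ((6 * (b / a + 1) : ℕ) * O : ℤ) ≤ (6 * (b / a + 1) : ℕ) * T + 3 * O) :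
    (O : ℝ) ≤ (1 + ε) * T := by
  set e := b / a + 1 with he
  have hb : (0 : ℝ) < b := by exact_mod_cast ha.trans_le hab
  have h1 : (1 : ℝ) ≤ ε * e := by
    have : b ≤ a * e := (Nat.lt_mul_div_succ b ha).le
    have : (b : ℝ) ≤ a * e := by exact_mod_cast this
    rw [hε, div_mul_eq_mul_div, le_div_iff₀ hb]
    linarith
  have hε1 : ε ≤ 1 := by
    rw [hε, div_le_one hb]
    exact_mod_cast hab
  have hε0 : 0 ≤ ε := by rw [hε]; positivity
  have h2 : (6 * e * O : ℝ) ≤ 6 * e * T + 3 * O := by exact_mod_cast h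
  have he0 : (0 : ℝ) < e := by rw [he]; positivity
  have h3 : (2 * e - 1) * O ≤ 2 * e * (T : ℝ) := by linarith
  have h4 : 2 * e * (O : ℝ) ≤ (1 + ε) * ((2 * e - 1) * O) := by
    have : (2 * e : ℝ) ≤ (1 + ε) * (2 * e - 1) := by nlinarith
    calc 2 * e * (O : ℝ) ≤ (1 + ε) * (2 * e - 1) * O := by gcongr
      _ = _ := by ring
  have h5 : (1 + ε) * ((2 * e - 1) * O) ≤ (1 + ε) * (2 * e * (T : ℝ)) := by gcongr
  refine le_of_mul_le_mul_left ?_ (show (0 : ℝ) < 2 * e by positivity)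
  linarith

theorem isApprox_solve {γ k r a b : ℕ} {ε : ℝ} {w : Fin m → List (Fin n)} {s : State} {ω : ℕ}
    (ha : 0 < a) (hab : a ≤ b) (hε : ε = a / b) (h0 : g 0 = false) (h1 : g 1 = true)
    (hw : Lists w S) (hk : 0 < k) (hr : 0 < r) (hS : ∀ u, multiplicity S u ≤ r)
    (h : Inv γ (n, m, k, r, a, b) (tokens w) ω m [] s)
    (hR : maxSize S = 0 ∨ ∀ D : Finset (Fin m), D.card ≤ k →
      Reliable g γ (n, m, k, r, a, b) S ω D) :
    IsApprox k ε (value g S) (solve g γ (n, m, k, r, a, b) s) := by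
  obtain ⟨⟨h2, h3⟩, h4⟩ := h.solve_spec h0 h1 rfl hw hk hr hS
  refine ⟨h2, h3, ?_⟩
  rcases hR with hR | hR
  · rw [optimum_eq_zero h0 hR, hε]
    push_cast
    positivity
  · exact isApprox_of_le ha hab hε (h4 hR)

theorem isApprox_nil {k : ℕ} {ε : ℝ} (hε : 0 ≤ ε) (h0 : g 0 = false) (hS : maxSize S = 0) :
    IsApprox k ε (value g S) [] := by
  refine ⟨by simp, by simp [selection], ?_⟩
  rw [optimum_eq_zero h0 hS]
  push_cast
  positivity

theorem maxSize_eq_zero (hS : ∀ u, multiplicity S u ≤ 0) : maxSize S = 0 := by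
  refine Nat.le_zero.1 (Finset.sup_le fun i _ => ?_)
  rw [Nat.le_zero, Finset.card_eq_zero, Finset.eq_empty_iff_forall_notMem]
  intro u hu
  have h := Nat.le_zero.1 (hS u)
  rw [multiplicity, Finset.card_eq_zero, Finset.filter_eq_empty_iff] at h
  exact h (Finset.mem_univ i) hu

theorem memory_eq_zero {γ : ℕ} {p : Params} (hr : p.2.2.2.1 = 0) (ω : ℕ) (t : List (Option ℕ)) :
    (coverageAlgorithm γ).memory p ω t = 0 := by
  induction t using List.reverseRecOn with
  | nil => simp [OnePassAlgorithm.memory, coverageAlgorithm, startMemory, hr]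
  | append_singleton t x ih =>
    rw [OnePassAlgorithm.memory, List.foldl_append]
    simp [coverageAlgorithm, stepMemory, hr]

theorem prob_ge {A : OnePassAlgorithm} {p : Params} {t : List (Option ℕ)}
    {P : List ℕ × List ℕ → Prop} {F : Finset ℕ} {y : ℕ} (hy : 0 < y)
    (hF : F.card * y ≤ A.seeds p)
    (h : ∀ ω < A.seeds p, ω ∉ F → P (A.answer p (A.memory p ω t))) :
    1 - 1 / (y : ℝ) ≤ A.prob p t P := by
  have hN : (0 : ℝ) < A.seeds p := by exact_mod_cast A.seeds_pos p
  have h1 : A.seeds p ≤ {ω : ℕ | ω < A.seeds p ∧ P (A.answer p (A.memory p ω t))}.ncard +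
      F.card := by
    have hfin : {ω : ℕ | ω < A.seeds p ∧ P (A.answer p (A.memory p ω t))}.Finite :=
      (Set.finite_lt_nat _).subset fun ω hω => hω.1
    have hsub : ((Finset.range (A.seeds p) \ F : Finset ℕ) : Set ℕ) ⊆
        {ω : ℕ | ω < A.seeds p ∧ P (A.answer p (A.memory p ω t))} := by
      intro ω hω
      have hω' := Finset.mem_sdiff.1 (Finset.mem_coe.1 hω)
      exact ⟨Finset.mem_range.1 hω'.1, h ω (Finset.mem_range.1 hω'.1) hω'.2⟩
    have h2 := Set.ncard_le_ncard hsub hfin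
    rw [Set.ncard_coe_finset] at h2
    have h3 := Finset.le_card_sdiff F (Finset.range (A.seeds p))
    rw [Finset.card_range] at h3
    omega
  have h1' : (A.seeds p : ℝ) ≤
      ({ω : ℕ | ω < A.seeds p ∧ P (A.answer p (A.memory p ω t))}.ncard : ℝ) + F.card := by
    exact_mod_cast h1
  have hF' : (F.card : ℝ) * y ≤ A.seeds p := by exact_mod_cast hF
  have hy' : (0 : ℝ) < y := by exact_mod_cast hy
  have hF2 : (F.card : ℝ) ≤ 1 / y * A.seeds p := by
    rw [one_div_mul_eq_div, le_div_iff₀ hy']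
    exact hF'
  rw [OnePassAlgorithm.prob, le_div_iff₀ hN, sub_mul, one_mul]
  linarith

theorem prob_success {γ k r a b : ℕ} {ε : ℝ} {w : Fin m → List (Fin n)}
    (hk : 0 < k) (ha : 0 < a) (hab : a ≤ b) (hε : ε = a / b) (hS : ∀ u, multiplicity S u ≤ r)
    (hw : Lists w S) :
    1 - 1 / ((m : ℝ) + 1) ^ γ ≤
      (coverageAlgorithm γ).prob (n, m, k, r, a, b) (stream w) fun out =>
        IsApprox k ε (fun D => (uniquelyCovered S D).card) out.1 ∧
        IsApprox k ε (fun D => (covered S D).card) out.2 := by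
  classical
  simp only [uniquelyCovered_card, covered_card]
  set p : Params := (n, m, k, r, a, b) with hp
  have hcast : ((m : ℝ) + 1) ^ γ = (((m + 1) ^ γ : ℕ) : ℝ) := by push_cast; rfl
  rw [hcast]
  have hy : 0 < (m + 1) ^ γ := by positivity
  have hε0 : 0 ≤ ε := by rw [hε]; positivity
  rcases Nat.eq_zero_or_pos r with hr | hr
  · refine prob_ge (F := ∅) hy (by simp) fun ω _ _ => ?_
    have h0 : maxSize S = 0 := maxSize_eq_zero (hr ▸ hS)
    have h1 : (coverageAlgorithm γ).answer p ((coverageAlgorithm γ).memory p ω (stream w)) =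
        ([], []) := by
      change output γ p _ = _
      simp [output, hp, hr]
    rw [h1]
    exact ⟨isApprox_nil hε0 rfl h0, isApprox_nil hε0 rfl h0⟩
  have hW : ∀ j, (tokens w j).length ≤ p.1 := length_tokens_le hw
  have hWn : ∀ j, ∀ u ∈ tokens w j, u < p.1 := fun j u => mem_tokens
  have hout : ∀ ω, (maxSize S = 0 ∨ ω ∉ unreliable (fun c => decide (c = 1)) γ p S ∪
      unreliable (fun c => decide (1 ≤ c)) γ p S) → ω < (coverageAlgorithm γ).seeds p →
      IsApprox k ε (value (fun c => decide (c = 1)) S) ((coverageAlgorithm γ).answer p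
        ((coverageAlgorithm γ).memory p ω (stream w))).1 ∧
      IsApprox k ε (value (fun c => decide (1 ≤ c)) S) ((coverageAlgorithm γ).answer p
        ((coverageAlgorithm γ).memory p ω (stream w))).2 := by
    intro ω hω hωN
    have hinv := inv_blocks γ p hW ω m
    rw [stream_eq_blocks, memory_eq hr.ne' rfl hW hWn ω List.prefix_rfl]
    change IsApprox k ε _ (output γ p _).1 ∧ IsApprox k ε _ (output γ p _).2
    have hr' : p.2.2.2.1 ≠ 0 := hr.ne'
    have hZ := hinv.bounded List.nil_prefix le_rfl hW hWn
    simp only [output, hr', decide_false, cond_false, base]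
    rw [unpack_pack (by omega) hZ]
    have hrel : ∀ g : ℕ → Bool, (maxSize S = 0 ∨ ω ∉ unreliable g γ p S) →
        (maxSize S = 0 ∨ ∀ D : Finset (Fin m), D.card ≤ k → Reliable g γ p S ω D) := by
      intro g hg
      refine hg.imp_right fun hg D hD => ?_
      by_contra hcon
      exact hg (Finset.mem_filter.2 ⟨Finset.mem_range.2 hωN, D, hD, hcon⟩)
    rw [Finset.mem_union, not_or] at hω
    exact ⟨isApprox_solve ha hab hε rfl rfl hw hk hr hS hinv (hrel _ (hω.imp_right And.left)),
      isApprox_solve ha hab hε rfl rfl hw hk hr hS hinv (hrel _ (hω.imp_right And.right))⟩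
  rcases Nat.eq_zero_or_pos (maxSize S) with h0 | h0
  · exact prob_ge (F := ∅) hy (by simp) fun ω hωN _ => hout ω (Or.inl h0) hωN
  · refine prob_ge hy (card_unreliable_union_le (S := S) (g := fun c => decide (c = 1))
      (g' := fun c => decide (1 ≤ c)) γ rfl rfl rfl rfl (p := p) rfl rfl hk h0)
      fun ω hωN hω => hout ω (Or.inr hω) hωN

end Success

/-! ### Space -/

section Space

theorem lt_two_pow_size_of_le {x y : ℕ} (h : x ≤ y) : x < 2 ^ Nat.size y :=
  h.trans_lt (Nat.lt_size_self y)

theorem log_lt_size {x y : ℕ} (h : x ≤ y) (hy : 0 < y) : Nat.log 2 x + 1 ≤ Nat.size y := by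
  rw [Nat.succ_le_iff]
  exact Nat.log_lt_of_lt_pow' (by have := Nat.size_pos.2 hy; omega) (lt_two_pow_size_of_le h)

/-- Number of bits of the memory, in terms of the number `s` of bits of `m + n + 2`. -/
theorem size_memory_le {γ n m k r a b : ℕ} (hk : 0 < k) (hkm : k ≤ m) (hr : 0 < r)
    {S : Fin m → Finset (Fin n)} {w : Fin m → List (Fin n)} (hw : Lists w S) {ω : ℕ}
    (hω : ω < (coverageAlgorithm γ).seeds (n, m, k, r, a, b)) {t : List (Option ℕ)}
    (ht : t <+: stream w) :
    Nat.size ((coverageAlgorithm γ).memory (n, m, k, r, a, b) ω t) ≤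
      16 * (4 * (2 + γ) + 4 + (5 + 12480 * (2 + γ)) * (24 + 4 * γ)) *
        (k ^ 3 * r * prec (n, m, k, r, a, b) ^ 3 * Nat.size (m + n + 2) ^ 4) := by
  set p : Params := (n, m, k, r, a, b) with hp
  set s := Nat.size (m + n + 2) with hs
  set E := prec p with hE
  have hW : ∀ j, (tokens w j).length ≤ p.1 := length_tokens_le hw
  have hWn : ∀ j, ∀ u ∈ tokens w j, u < p.1 := fun j u => mem_tokens
  have hspos : 0 < s := Nat.size_pos.2 (by omega)
  have hEpos : 0 < E := prec_pos p
  rw [stream_eq_blocks] at ht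
  rw [memory_eq hr.ne' rfl hW hWn ω ht]
  obtain ⟨i, hi, v, hv, hinv⟩ := exists_inv γ p hW ω ht
  set σ := t.foldl (update γ p) (ω, 0, 0, [], [])
  have hL : reps γ p ≤ (2 + γ) * k * s := by
    have h1 : Nat.log 2 (m + 1) + 1 ≤ s := log_lt_size (by omega) (by omega)
    have h2 : 1 ≤ k * s := Nat.mul_pos hk hspos
    have h3 : γ ≤ k * γ := Nat.le_mul_of_pos_left γ hk
    calc reps γ p = 1 + (k + γ) * (Nat.log 2 (m + 1) + 1) := rfl
      _ ≤ k * s + (k + k * γ) * s := by gcongr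
      _ = _ := by ring
  have hJ : levels p ≤ s := log_lt_size (by simp only [hp]; omega) (by omega)
  have hH : harm k ≤ 2 * s := by
    have : Nat.log 2 k + 1 ≤ s := log_lt_size (by omega) (by omega)
    unfold harm
    omega
  have hwid : width p ≤ 5 * (k * r * s * E) := by
    have h1 : 1 ≤ r * s * E := by
      have := Nat.mul_pos (Nat.mul_pos hr hspos) hEpos
      exact this
    calc width p = k * 1 + 2 * k * r * harm k * E := by rw [mul_one]; rfl
      _ ≤ k * (r * s * E) + 2 * k * r * (2 * s) * E := by gcongr
      _ = _ := by ring
  have hcap : cap p ≤ 2080 * (k * E ^ 2) := by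
    have h1 : 1 ≤ E ^ 2 := Nat.one_le_pow _ _ hEpos
    calc cap p = 32 * k * (64 * E ^ 2 + 1) := rfl
      _ ≤ 32 * k * (64 * E ^ 2 + E ^ 2) := by gcongr
      _ = _ := by ring
  have hsize1 : Nat.size σ.1 ≤ 4 * (2 + γ) * (k * s ^ 2) := by
    rw [hinv.seed, Nat.size_le]
    have hq : prm n ≤ 2 ^ (s + 1) := by
      have h1 := (prm_spec n).2.2
      have h2 : n + 1 < 2 ^ s := lt_two_pow_size_of_le (by omega)
      rw [pow_succ]
      omega
    refine hω.trans_le ?_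
    calc (coverageAlgorithm γ).seeds p = (prm n * prm n) ^ reps γ p := rfl
      _ ≤ (2 ^ (s + 1) * 2 ^ (s + 1)) ^ reps γ p := by gcongr
      _ = 2 ^ ((s + 1 + (s + 1)) * reps γ p) := by rw [← pow_add, ← pow_mul]
      _ ≤ 2 ^ (4 * (2 + γ) * (k * s ^ 2)) := by
          refine Nat.pow_le_pow_right (by norm_num) ?_
          calc (s + 1 + (s + 1)) * reps γ p ≤ (4 * s) * ((2 + γ) * k * s) := by
                gcongr
                omega
            _ = _ := by ring
  have hsize2 : Nat.size σ.2.1 ≤ s := by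
    rw [hinv.pos]
    exact Nat.size_le_size (by omega)
  have hsize3 : Nat.size σ.2.2.1 ≤ s := by
    rw [hinv.size]
    have h1 := hv.length_le.trans (hW i)
    exact Nat.size_le_size (by simp only [hp] at h1; omega)
  have hZ : Nat.size ((p.2.1 + p.1 + levels p * reps γ p + 2) ^ 4) ≤ (24 + 4 * γ) * s := by
    have h1 : m + n + 2 < 2 ^ s := Nat.lt_size_self _
    have h2 : s < 2 ^ s := Nat.lt_two_pow_self
    have h3 : 3 + γ < 2 ^ (3 + γ) := Nat.lt_two_pow_self
    have h4 : p.2.1 + p.1 + levels p * reps γ p + 2 < 2 ^ (3 * s + (3 + γ)) := by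
      have h5 : levels p * reps γ p ≤ 2 ^ s * ((2 + γ) * 2 ^ s * 2 ^ s) := by
        refine Nat.mul_le_mul (hJ.trans h2.le) (hL.trans ?_)
        gcongr
        omega
      have h6 : 2 ^ s ≤ 2 ^ s * 2 ^ s * 2 ^ s := by
        have : 0 < 2 ^ s * 2 ^ s := by positivity
        rw [mul_assoc]
        exact Nat.le_mul_of_pos_right _ this
      calc p.2.1 + p.1 + levels p * reps γ p + 2
          = (m + n + 2) + levels p * reps γ p := by simp only [hp]; ring
        _ < 2 ^ s * 2 ^ s * 2 ^ s + 2 ^ s * ((2 + γ) * 2 ^ s * 2 ^ s) := by omega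
        _ = 2 ^ s * 2 ^ s * 2 ^ s * (3 + γ) := by ring
        _ ≤ 2 ^ s * 2 ^ s * 2 ^ s * 2 ^ (3 + γ) := by gcongr
        _ = _ := by rw [← pow_add, ← pow_add, ← pow_add]; congr 1; ring
    rw [Nat.size_le]
    calc (p.2.1 + p.1 + levels p * reps γ p + 2) ^ 4 < (2 ^ (3 * s + (3 + γ))) ^ 4 := by gcongr
      _ = 2 ^ ((3 * s + (3 + γ)) * 4) := by rw [← pow_mul]
      _ ≤ 2 ^ ((24 + 4 * γ) * s) := by
          refine Nat.pow_le_pow_right (by norm_num) ?_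
          nlinarith
  have hlen1 : σ.2.2.2.1.length ≤ 5 * (k ^ 3 * r * E ^ 3 * s ^ 3) := by
    refine hinv.length_le.trans (hwid.trans ?_)
    have e1 : k ≤ k ^ 3 := Nat.le_self_pow (by norm_num) k
    have e2 : s ≤ s ^ 3 := Nat.le_self_pow (by norm_num) s
    have e3 : E ≤ E ^ 3 := Nat.le_self_pow (by norm_num) E
    calc 5 * (k * r * s * E) ≤ 5 * (k ^ 3 * r * s ^ 3 * E ^ 3) := by gcongr
      _ = _ := by ring
  have hlen2 : σ.2.2.2.2.length ≤ 12480 * (2 + γ) * (k ^ 3 * r * E ^ 3 * s ^ 3) := by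
    have h1 : 1 ≤ k * r * s * E :=
      Nat.mul_pos (Nat.mul_pos (Nat.mul_pos hk hr) hspos) hEpos
    calc σ.2.2.2.2.length ≤ (width p + 1) * (levels p * reps γ p) * cap p :=
          hinv.recs_length_le hv
      _ ≤ (6 * (k * r * s * E)) * (s * ((2 + γ) * k * s)) * (2080 * (k * E ^ 2)) := by
          gcongr
          omega
      _ = _ := by ring
  have hbits := size_pack_le (hinv.bounded hv hi hW hWn)
  change Nat.size (pack (base γ p) σ) ≤ _ at hbits
  refine hbits.trans ?_
  have hP1 : k * s ^ 2 ≤ k ^ 3 * r * E ^ 3 * s ^ 4 := by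
    have e1 : k ≤ k ^ 3 := Nat.le_self_pow (by norm_num) k
    have e2 : s ^ 2 ≤ s ^ 4 := Nat.pow_le_pow_right hspos (by norm_num)
    have e3 : 1 ≤ r * E ^ 3 := Nat.mul_pos hr (by positivity)
    calc k * s ^ 2 = k * 1 * s ^ 2 := by ring
      _ ≤ k ^ 3 * (r * E ^ 3) * s ^ 4 := by gcongr
      _ = _ := by ring
  have hP2 : s ≤ k ^ 3 * r * E ^ 3 * s ^ 4 := by
    have e2 : s ≤ s ^ 4 := Nat.le_self_pow (by norm_num) s
    have e3 : 1 ≤ k ^ 3 * r * E ^ 3 := Nat.mul_pos (Nat.mul_pos (by positivity) hr) (by positivity)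
    calc s = 1 * s := by ring
      _ ≤ k ^ 3 * r * E ^ 3 * s ^ 4 := by gcongr
  set P := k ^ 3 * r * E ^ 3 * s ^ 4 with hP
  calc 16 * (Nat.size σ.1 + Nat.size σ.2.1 + Nat.size σ.2.2.1 + 2 +
        (σ.2.2.2.1.length + σ.2.2.2.2.length) *
          Nat.size ((p.2.1 + p.1 + levels p * reps γ p + 2) ^ 4))
      ≤ 16 * (4 * (2 + γ) * P + P + P + 2 * P +
        (5 * (k ^ 3 * r * E ^ 3 * s ^ 3) + 12480 * (2 + γ) * (k ^ 3 * r * E ^ 3 * s ^ 3)) *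
          ((24 + 4 * γ) * s)) := by
        gcongr
        · exact hsize1.trans (by gcongr)
        · omega
        · omega
        · omega
    _ = _ := by rw [hP]; ring

theorem size_le_log {x : ℕ} (hx : 3 ≤ x) : (Nat.size x : ℝ) ≤ 3 * Real.log x := by
  have h1 : 1 ≤ Real.log x := by
    rw [Real.le_log_iff_exp_le (by positivity)]
    exact Real.exp_one_lt_d9.le.trans (le_trans (by norm_num) (by exact_mod_cast hx : (3 : ℝ) ≤ x))
  have hpos : 0 < Nat.size x := Nat.size_pos.2 (by omega)
  have h2 : 2 ^ (Nat.size x - 1) ≤ x := by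
    rw [← Nat.lt_size]
    omega
  have h3 : ((Nat.size x - 1 : ℕ) : ℝ) * Real.log 2 ≤ Real.log x := by
    rw [← Real.log_pow]
    exact Real.log_le_log (by positivity) (by exact_mod_cast h2)
  rw [Nat.cast_sub hpos] at h3
  have h4 := Real.log_two_gt_d9
  push_cast at h3
  have h5 : (1 : ℝ) ≤ Nat.size x := by exact_mod_cast hpos
  nlinarith

theorem prec_le {n m k r a b : ℕ} {ε : ℝ} (ha : 0 < a) (hab : a ≤ b) (hε : ε = a / b) :
    (prec (n, m, k, r, a, b) : ℝ) ≤ 12 * ε⁻¹ := by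
  have ha' : (0 : ℝ) < a := by exact_mod_cast ha
  have h1 : ((b / a : ℕ) : ℝ) ≤ b / a := Nat.cast_div_le
  have h2 : (1 : ℝ) ≤ b / a := by
    rw [one_le_div ha']
    exact_mod_cast hab
  rw [hε, inv_div]
  simp only [prec]
  push_cast
  linarith

theorem usesSpaceAtMost {γ n m k r a b : ℕ} {ε : ℝ} (hk : 0 < k) (hkm : k ≤ m) (ha : 0 < a)
    (hab : a ≤ b) (hε : ε = a / b) {S : Fin m → Finset (Fin n)} {w : Fin m → List (Fin n)}
    (hw : Lists w S) :
    (coverageAlgorithm γ).UsesSpaceAtMost (n, m, k, r, a, b) (stream w)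
      (((16 * (4 * (2 + γ) + 4 + (5 + 12480 * (2 + γ)) * (24 + 4 * γ)) : ℕ) * 12 ^ 3 * 3 ^ 4 : ℝ) *
        (ε⁻¹ ^ 4 * (k : ℝ) ^ 3 * (r : ℝ)) * Real.log ((m : ℝ) + (n : ℝ) + 2) ^ 4) := by
  intro ω hω t ht
  rcases Nat.eq_zero_or_pos r with rfl | hr
  · rw [memory_eq_zero rfl]
    simp
  set c := 16 * (4 * (2 + γ) + 4 + (5 + 12480 * (2 + γ)) * (24 + 4 * γ))
  have h1 := size_memory_le hk hkm hr hw hω ht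
  have h2 := size_le_log (x := m + n + 2) (by omega)
  have h3 := prec_le (n := n) (m := m) (k := k) (r := r) ha hab hε
  have hb : (0 : ℝ) < b := by exact_mod_cast ha.trans_le hab
  have ha' : (0 : ℝ) < a := by exact_mod_cast ha
  have h4 : 1 ≤ ε⁻¹ := by
    rw [hε, inv_div, one_le_div ha']
    exact_mod_cast hab
  have h5 : ε⁻¹ ^ 3 ≤ ε⁻¹ ^ 4 := pow_le_pow_right₀ h4 (by norm_num)
  have h6 : ((m + n + 2 : ℕ) : ℝ) = (m : ℝ) + n + 2 := by push_cast; ring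
  rw [h6] at h2
  have h7 : 0 ≤ Real.log ((m : ℝ) + n + 2) := by
    apply Real.log_nonneg
    have : (0 : ℝ) ≤ (m : ℝ) + n := by positivity
    linarith
  calc (Nat.size ((coverageAlgorithm γ).memory (n, m, k, r, a, b) ω t) : ℝ)
      ≤ (c * (k ^ 3 * r * prec (n, m, k, r, a, b) ^ 3 * Nat.size (m + n + 2) ^ 4) : ℕ) := by
        exact_mod_cast h1
    _ = c * (k ^ 3 * r * (prec (n, m, k, r, a, b) : ℝ) ^ 3 * (Nat.size (m + n + 2) : ℝ) ^ 4) := by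
        push_cast
        ring
    _ ≤ c * (k ^ 3 * r * (12 * ε⁻¹) ^ 3 * (3 * Real.log ((m : ℝ) + n + 2)) ^ 4) := by gcongr
    _ = c * 12 ^ 3 * 3 ^ 4 * (ε⁻¹ ^ 3 * k ^ 3 * r) * Real.log ((m : ℝ) + n + 2) ^ 4 := by ring
    _ ≤ c * 12 ^ 3 * 3 ^ 4 * (ε⁻¹ ^ 4 * k ^ 3 * r) * Real.log ((m : ℝ) + n + 2) ^ 4 := by gcongr

end Space

end StreamCoverage

theorem mainTheorem4 (γ : ℕ) :
    ∃ (C : ℝ) (c : ℕ) (A : StreamCoverage.OnePassAlgorithm),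
      ∀ (n m k r a b : ℕ), 1 ≤ k → k ≤ m → 0 < a → a ≤ b →
      ∀ (ε : ℝ), ε = (a : ℝ) / (b : ℝ) →
      ∀ (S : Fin m → Finset (Fin n)), (∀ u, StreamCoverage.multiplicity S u ≤ r) →
      ∀ (w : Fin m → List (Fin n)), StreamCoverage.Lists w S →
        A.UsesSpaceAtMost (n, m, k, r, a, b) (StreamCoverage.stream w)
          (C * (ε⁻¹ ^ 4 * (k : ℝ) ^ 3 * (r : ℝ)) * Real.log ((m : ℝ) + (n : ℝ) + 2) ^ c) ∧
        1 - 1 / ((m : ℝ) + 1) ^ γ ≤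
          A.prob (n, m, k, r, a, b) (StreamCoverage.stream w) (fun out =>
            StreamCoverage.IsApprox k ε (fun D => (StreamCoverage.uniquelyCovered S D).card) out.1 ∧
            StreamCoverage.IsApprox k ε (fun D => (StreamCoverage.covered S D).card) out.2) :=
  ⟨_, 4, StreamCoverage.coverageAlgorithm γ,
    fun _ _ _ _ _ _ hk hkm ha hab _ hε _ hS _ hw =>
      ⟨StreamCoverage.usesSpaceAtMost hk hkm ha hab hε hw,
        StreamCoverage.prob_success hk ha hab hε hS hw⟩⟩
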